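/- Let $p\ge 2$ be an even integer. A \emph{$p$-regular trace map} is a pair $\mathfrak b=(\pi,\alpha)$ of permutations of a finite set of half-edges $\{1,\dots,m\}$, where all cycles of $\pi$ (the vertices) have length $p$ and $\alpha$ is an involution without fixed points whose $2$-cycles are the edges; its connected components are the orbits of $\langle \pi,\alpha\rangle$, and $\gamma(\mathfrak b)$ is their number. For fixed $\pi$, two maps $\mathfrak b=(\pi,\alpha)$ and $\mathfrak b'=(\pi,\alpha')$ differ by a switch if $\alpha'$ is obtained from $\alpha$ by exchanging the end points of two edges (that is, $\alpha'=\tau\alpha\tau$ for a transposition $\tau$). The non-crossing order $\le$ is the reflexive transitive closure of the relation "$\mathfrak b'$ and $\mathfrak b$ differ by a switch and $\gamma(\mathfrak b')=\gamma(\mathfrak b)+1$". A \emph{distribution} $a$ on the $p$-regular trace maps is a real-valued function $\mathfrak b\mapsto a(\mathfrak b)$ that is invariant under relabelling of the half-edges, multiplicative over disjoint unions, and equal to $1$ on the empty map. Its free cumulants $\kappa_{\mathfrak b}(a)$ are determined by $$a(\mathfrak b)=\sum_{\mathfrak b'\le \mathfrak b}\kappa_{\mathfrak b'}(a)\qquad\text{for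 every } p\text{-regular trace map } \mathfrak b .$$ For $n\ge 1$ let $\mathcal B_n$ be the set of isomorphism classes of connected rooted $p$-regular trace maps with $n$ vertices, where the root is a distinguished half-edge, and put $$m_n(a)=\sum_{\mathfrak b\in\mathcal B_n}a(\mathfrak b),\qquad \kappa_n(a)=\sum_{\mathfrak b\in\mathcal B_n}\kappa_{\mathfrak b}(a),\qquad m_0(a)=\kappa_0(a)=1 .$$ A real sequence $(u_n)_{n\ge0}$ is exponentially bounded if there is a constant $M>0$ with $|u_n|\le M^n$ for all $n\ge 0$. \textbf{Proposition.} For every distribution $a$ on the $p$-regular trace maps, the following are equivalent: (i) the sequence of moments $(m_n(a))_{n\ge 0}$ is exponentially bounded; (ii) the sequence of free cumulants $(\kappa_n(a))_{n\ge 0}$ is exponentially bounded. -/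

import Mathlib

namespace TensorFree

/-- A `p`-regular trace map (combinatorial map without boundary) whose set of half-edges is `H`.
The cycles of `vert` are the vertices, each of them together with the cyclic order of the
half-edges attached to it; all of them have length `p`. The map `edge` is an involution without
fixed point; its 2-cycles are the edges. -/
@[ext]
structure TraceMap (p : ℕ) (H : Type) where
  vert : Equiv.Perm H
  edge : Equiv.Perm H
  regular : ∀ h, Function.minimalPeriod vert h = p
  edge_edge : ∀ h, edge (edge h) = h
  edge_ne : ∀ h, edge h ≠ h

namespace TraceMap

variable {p : ℕ} {H H' H'' : Type}

instance [Finite H] : Finite (TraceMap p H) :=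
  Finite.of_injective (fun b : TraceMap p H => (b.vert, b.edge)) (by
    intro b c h
    simp only [Prod.mk.injEq] at h
    exact TraceMap.ext h.1 h.2)

/-- Transport of a trace map along a relabelling of its half-edges. -/
def relabel (e : H ≃ H') (b : TraceMap p H) : TraceMap p H' where
  vert := e.permCongr b.vert
  edge := e.permCongr b.edge
  regular h := by
    refine Eq.trans ?_ (b.regular (e.symm h))
    rw [Function.minimalPeriod_eq_minimalPeriod_iff]
    have hc : Function.Semiconj e b.vert (e.permCongr b.vert) := fun x => by simp
    intro n
    have := (hc.iterate_right n) (e.symm h)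
    simp only [Equiv.apply_symm_apply] at this
    simp only [Function.IsPeriodicPt, Function.IsFixedPt]
    rw [← this, ← Equiv.eq_symm_apply]
  edge_edge h := by simp [b.edge_edge]
  edge_ne h := by
    have := b.edge_ne (e.symm h)
    intro h'
    apply this
    rw [Equiv.permCongr_apply] at h'
    exact e.injective (by simpa using h')

/-- The disjoint union of two trace maps. -/
def disjUnion (b : TraceMap p H) (c : TraceMap p H') : TraceMap p (H ⊕ H') where
  vert := Equiv.sumCongr b.vert c.vert
  edge := Equiv.sumCongr b.edge c.edge
  regular h := by
    rcases h with h | h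
    · refine Eq.trans ?_ (b.regular h)
      rw [Function.minimalPeriod_eq_minimalPeriod_iff]
      intro n
      have hc : Function.Semiconj (Sum.inl : H → H ⊕ H') b.vert
        (Equiv.sumCongr b.vert c.vert) := fun x => by simp
      have := (hc.iterate_right n) h
      simp only [Function.IsPeriodicPt, Function.IsFixedPt]
      rw [← this, Sum.inl.injEq]
    · refine Eq.trans ?_ (c.regular h)
      rw [Function.minimalPeriod_eq_minimalPeriod_iff]
      intro n
      have hc : Function.Semiconj (Sum.inr : H' → H ⊕ H') c.vert
        (Equiv.sumCongr b.vert c.vert) := fun x => by simp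
      have := (hc.iterate_right n) h
      simp only [Function.IsPeriodicPt, Function.IsFixedPt]
      rw [← this, Sum.inr.injEq]
  edge_edge h := by rcases h with h | h <;> simp [b.edge_edge, c.edge_edge]
  edge_ne h := by rcases h with h | h <;> simp [b.edge_ne, c.edge_ne]

/-- Two half-edges are adjacent if one follows the other around a vertex or if they are the two
ends of an edge. -/
def Adj (b : TraceMap p H) (x y : H) : Prop := y = b.vert x ∨ y = b.edge x

/-- The equivalence relation of being in the same connected component. -/
def componentSetoid (b : TraceMap p H) : Setoid H := Relation.EqvGen.setoid b.Adj

/-- The number of connected components. -/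
noncomputable def numComponents (b : TraceMap p H) : ℕ := Nat.card (Quotient b.componentSetoid)

/-- `b` is connected if it has exactly one connected component (so the empty map is excluded). -/
def IsConnected (b : TraceMap p H) : Prop := b.numComponents = 1

/-- `c` is obtained from `b` by a switch: the two maps have the same vertices, and the ends `x` and
`y` of two edges of `b` are exchanged. -/
def IsSwitch (c b : TraceMap p H) : Prop :=
  open Classical in
  c.vert = b.vert ∧ ∃ x y : H, c.edge = Equiv.swap x y * b.edge * Equiv.swap x y

/-- The generating relation of the non-crossing poset: `c` is obtained from `b` by a switch and has
one more connected component. -/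
def Step (c b : TraceMap p H) : Prop :=
  c.IsSwitch b ∧ c.numComponents = b.numComponents + 1

/-- In a switch, the product of the two edge involutions is a product of two transpositions. -/
theorem IsSwitch.edge_mul_edge {c b : TraceMap p H} (h : c.IsSwitch b) :
    open Classical in
    c.vert = b.vert ∧ ∃ x y : H,
      b.edge * c.edge = Equiv.swap (b.edge x) (b.edge y) * Equiv.swap x y := by
  classical
  obtain ⟨hv, x, y, h⟩ := h
  refine ⟨hv, x, y, ?_⟩
  have hb : b.edge⁻¹ = b.edge := by
    ext z
    rw [Equiv.Perm.inv_eq_iff_eq, b.edge_edge]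
  rw [Equiv.swap_apply_apply, hb, h]
  simp only [mul_assoc]

theorem numComponents_lt_of_transGen {c b : TraceMap p H} (h : Relation.TransGen Step c b) :
    b.numComponents < c.numComponents := by
  induction h with
  | single h => have := h.2; omega
  | tail _ h ih => have := h.2; omega

theorem eq_or_transGen_of_reflTransGen {c b : TraceMap p H}
    (h : Relation.ReflTransGen Step c b) : c = b ∨ Relation.TransGen Step c b := by
  rcases Relation.reflTransGen_iff_eq_or_transGen.1 h with h | h
  · exact Or.inl h.symm
  · exact Or.inr h

/-- The non-crossing poset: `c ≤ b` if `c` is obtained from `b` by a (possibly empty) sequence of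
switches each of which creates one more connected component. -/
instance : PartialOrder (TraceMap p H) where
  le c b := Relation.ReflTransGen Step c b
  lt c b := Relation.TransGen Step c b
  le_refl _ := Relation.ReflTransGen.refl
  le_trans _ _ _ := Relation.ReflTransGen.trans
  lt_iff_le_not_ge c b := by
    constructor
    · intro h
      refine ⟨h.to_reflTransGen, fun h' => ?_⟩
      have h1 := numComponents_lt_of_transGen h
      rcases eq_or_transGen_of_reflTransGen h' with h' | h'
      · rw [h'] at h1; omega
      · have h2 := numComponents_lt_of_transGen h'; omega
    · rintro ⟨h, h'⟩
      rcases eq_or_transGen_of_reflTransGen h with h | h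
      · exact absurd (h ▸ Relation.ReflTransGen.refl) h'
      · exact h
  le_antisymm c b h h' := by
    rcases eq_or_transGen_of_reflTransGen h with h | h
    · exact h
    rcases eq_or_transGen_of_reflTransGen h' with h' | h'
    · exact h'.symm
    have h1 := numComponents_lt_of_transGen h
    have h2 := numComponents_lt_of_transGen h'
    omega

theorem lt_iff_transGen {c b : TraceMap p H} : c < b ↔ Relation.TransGen Step c b := Iff.rfl

noncomputable instance [Finite H] : Fintype (TraceMap p H) := Fintype.ofFinite _

theorem relabel_trans (e : H ≃ H') (f : H' ≃ H'') (b : TraceMap p H) :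
    (b.relabel e).relabel f = b.relabel (e.trans f) := by
  apply TraceMap.ext <;> ext x <;> simp [relabel]

theorem relabel_refl (b : TraceMap p H) : b.relabel (Equiv.refl H) = b := by
  apply TraceMap.ext <;> ext x <;> simp [relabel]

theorem numComponents_relabel (e : H ≃ H') (b : TraceMap p H) :
    (b.relabel e).numComponents = b.numComponents := by
  symm
  refine Nat.card_congr (Quotient.congr e fun x y => ?_)
  constructor
  · intro h
    induction h with
    | rel x y h =>
      refine Relation.EqvGen.rel _ _ ?_
      rcases h with rfl | rfl
      · left; simp [relabel]
      · right; simp [relabel]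
    | refl x => exact Relation.EqvGen.refl _
    | symm x y _ ih => exact Relation.EqvGen.symm _ _ ih
    | trans x y z _ _ ih ih' => exact Relation.EqvGen.trans _ _ _ ih ih'
  · intro h
    have key : ∀ u v : H', Relation.EqvGen (b.relabel e).Adj u v →
        Relation.EqvGen b.Adj (e.symm u) (e.symm v) := by
      intro u v h
      induction h with
      | rel x y h =>
        refine Relation.EqvGen.rel _ _ ?_
        rcases h with rfl | rfl
        · left; simp [relabel]
        · right; simp [relabel]
      | refl x => exact Relation.EqvGen.refl _
      | symm x y _ ih => exact Relation.EqvGen.symm _ _ ih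
      | trans x y z _ _ ih ih' => exact Relation.EqvGen.trans _ _ _ ih ih'
    have h' := key _ _ h
    rw [Equiv.symm_apply_apply, Equiv.symm_apply_apply] at h'
    exact h'

theorem Step.relabel {c b : TraceMap p H} (h : Step c b) (e : H ≃ H') :
    Step (c.relabel e) (b.relabel e) := by
  classical
  obtain ⟨⟨hv, x, y, he⟩, hn⟩ := h
  refine ⟨⟨?_, e x, e y, ?_⟩, ?_⟩
  · simp [TraceMap.relabel, hv]
  · ext z
    have hz : ∀ w, Equiv.swap (e x) (e y) (e w) = e (Equiv.swap x y w) := fun w => by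
      rw [e.injective.swap_apply]
    have hz' : e.symm (Equiv.swap (e x) (e y) z) = Equiv.swap x y (e.symm z) := by
      rw [Equiv.symm_apply_eq, ← hz, Equiv.apply_symm_apply]
    simp only [TraceMap.relabel, he, Equiv.permCongr_apply, Equiv.Perm.mul_apply, hz, hz']
  · rw [numComponents_relabel, numComponents_relabel, hn]

theorem lt_relabel {c b : TraceMap p H} (h : c < b) (e : H ≃ H') :
    c.relabel e < b.relabel e := by
  rw [lt_iff_transGen] at h ⊢
  induction h with
  | single h => exact Relation.TransGen.single (h.relabel e)
  | tail _ h ih => exact Relation.TransGen.tail ih (h.relabel e)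

end TraceMap

/-- A distribution on the `p`-regular trace maps: a real-valued function of trace maps that does not
depend on the names of the half-edges, is multiplicative over disjoint unions (the morphism
property), and is equal to `1` on the empty map. -/
structure Distribution (p : ℕ) where
  val : ∀ {m : ℕ}, TraceMap p (Fin m) → ℝ
  val_relabel : ∀ {m : ℕ} (e : Equiv.Perm (Fin m)) (b : TraceMap p (Fin m)),
    val (b.relabel e) = val b
  val_disjUnion : ∀ {m m' : ℕ} (b : TraceMap p (Fin m)) (c : TraceMap p (Fin m')),
    val ((b.disjUnion c).relabel finSumFinEquiv) = val b * val c
  val_empty : ∀ b : TraceMap p (Fin 0), val b = 1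

/-- A connected `p`-regular trace map with `n` vertices (that is, with `p * n` half-edges), whose
half-edges are labelled, together with a distinguished half-edge, its root. -/
structure LabelledRootedMap (p n : ℕ) where
  map : TraceMap p (Fin (p * n))
  connected : map.IsConnected
  root : Fin (p * n)

/-- Isomorphism of rooted maps. -/
instance LabelledRootedMap.setoid (p n : ℕ) : Setoid (LabelledRootedMap p n) where
  r b c := ∃ e : Equiv.Perm (Fin (p * n)), b.map.relabel e = c.map ∧ e b.root = c.root
  iseqv := by
    refine ⟨fun b => ⟨Equiv.refl _, b.map.relabel_refl, rfl⟩, ?_, ?_⟩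
    · rintro b c ⟨e, h, h'⟩
      refine ⟨e.symm, ?_, ?_⟩
      · rw [← h, TraceMap.relabel_trans, Equiv.self_trans_symm, TraceMap.relabel_refl]
      · rw [← h', Equiv.symm_apply_apply]
    · rintro b c d ⟨e, h, h'⟩ ⟨f, k, k'⟩
      refine ⟨e.trans f, ?_, ?_⟩
      · rw [← k, ← h, TraceMap.relabel_trans]
      · rw [← k', ← h', Equiv.trans_apply]

/-- The set of connected rooted `p`-regular trace maps with `n` unlabelled vertices. -/
def RootedMap (p n : ℕ) : Type := Quotient (LabelledRootedMap.setoid p n)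

instance (p n : ℕ) : Finite (LabelledRootedMap p n) :=
  Finite.of_injective (fun b : LabelledRootedMap p n => (b.map, b.root)) (by
    rintro ⟨b, hb, r⟩ ⟨c, hc, s⟩ h
    simp only [Prod.mk.injEq] at h
    obtain ⟨rfl, rfl⟩ := h
    rfl)

instance (p n : ℕ) : Finite (RootedMap p n) :=
  inferInstanceAs (Finite (Quotient (LabelledRootedMap.setoid p n)))

noncomputable instance (p n : ℕ) : Fintype (RootedMap p n) := Fintype.ofFinite _

namespace Distribution

variable {p : ℕ} (a : Distribution p)

/-- The `n`-th moment: the sum of the values of `a` over all connected rooted `p`-regular trace maps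
with `n` vertices, and `1` for `n = 0`. -/
noncomputable def moment (n : ℕ) : ℝ :=
  if n = 0 then 1
  else ∑ b : RootedMap p n, Quotient.lift (fun b : LabelledRootedMap p n => a.val b.map)
    (by
      rintro b c ⟨e, h, _⟩
      show a.val b.map = a.val c.map
      rw [← h, a.val_relabel]) b

open Classical in
/-- The free cumulant of a map: the solution of `a b = ∑ c ≤ b, κ c`
(see `sum_mapCumulant`). -/
noncomputable def mapCumulant {m : ℕ} (b : TraceMap p (Fin m)) : ℝ :=
  a.val b - ∑ c : {c : TraceMap p (Fin m) // c < b}, mapCumulant c.1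
termination_by wellFounded_lt.wrap b
decreasing_by exact c.2

open Classical in
/-- The free cumulants satisfy the moment-cumulant relation over the non-crossing poset. -/
theorem sum_mapCumulant {m : ℕ} (b : TraceMap p (Fin m)) :
    a.val b = ∑ c : TraceMap p (Fin m) with c ≤ b, a.mapCumulant c := by
  have h1 : (Finset.univ.filter fun c : TraceMap p (Fin m) => c ≤ b)
      = insert b (Finset.univ.filter fun c => c < b) := by
    ext c
    simp [le_iff_eq_or_lt]
  rw [h1, Finset.sum_insert (by simp), mapCumulant,
    ← Finset.sum_subtype (Finset.univ.filter fun c => c < b) (by simp) a.mapCumulant]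
  ring

open Classical in
/-- The moment-cumulant relation determines the free cumulants. -/
theorem mapCumulant_unique {m : ℕ} (k : TraceMap p (Fin m) → ℝ)
    (hk : ∀ b : TraceMap p (Fin m), a.val b = ∑ c : TraceMap p (Fin m) with c ≤ b, k c) :
    k = a.mapCumulant := by
  funext b
  induction b using WellFoundedLT.induction with
  | ind b ih =>
    have h1 : (Finset.univ.filter fun c : TraceMap p (Fin m) => c ≤ b)
        = insert b (Finset.univ.filter fun c => c < b) := by
      ext c
      simp [le_iff_eq_or_lt]
    have h2 := (hk b).symm.trans (a.sum_mapCumulant b)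
    rw [h1, Finset.sum_insert (by simp), Finset.sum_insert (by simp),
      Finset.sum_congr rfl (fun c hc => ih c (by simpa using hc))] at h2
    exact add_right_cancel h2

theorem mapCumulant_relabel {m : ℕ} (e : Equiv.Perm (Fin m)) (b : TraceMap p (Fin m)) :
    a.mapCumulant (b.relabel e) = a.mapCumulant b := by
  classical
  have inv1 : ∀ c : TraceMap p (Fin m), (c.relabel e).relabel e.symm = c := fun c => by
    rw [TraceMap.relabel_trans, Equiv.self_trans_symm, TraceMap.relabel_refl]
  have inv2 : ∀ c : TraceMap p (Fin m), (c.relabel e.symm).relabel e = c := fun c => by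
    rw [TraceMap.relabel_trans, Equiv.symm_trans_self, TraceMap.relabel_refl]
  have hlt : ∀ c d : TraceMap p (Fin m), c.relabel e < d.relabel e ↔ c < d := fun c d =>
    ⟨fun h => by simpa [inv1] using TraceMap.lt_relabel h e.symm,
      fun h => TraceMap.lt_relabel h e⟩
  let E : TraceMap p (Fin m) ≃ TraceMap p (Fin m) :=
    ⟨fun c => c.relabel e, fun c => c.relabel e.symm, inv1, inv2⟩
  induction b using WellFoundedLT.induction with
  | ind b ih =>
    rw [mapCumulant, mapCumulant, a.val_relabel]
    congr 1
    symm
    refine Fintype.sum_equiv (E.subtypeEquiv fun c => (hlt c b).symm) _ _ ?_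
    rintro ⟨c, hc⟩
    exact (ih c hc).symm

/-- The `n`-th free cumulant: the sum of the free cumulants of all connected rooted `p`-regular
trace maps with `n` vertices, and `1` for `n = 0`. -/
noncomputable def freeCumulant (n : ℕ) : ℝ :=
  if n = 0 then 1
  else ∑ b : RootedMap p n,
    Quotient.lift (fun b : LabelledRootedMap p n => a.mapCumulant b.map)
    (by
      rintro b c ⟨e, h, _⟩
      show a.mapCumulant b.map = a.mapCumulant c.map
      rw [← h, a.mapCumulant_relabel]) b

end Distribution

/-- A real sequence is exponentially bounded. -/
def ExponentiallyBounded (u : ℕ → ℝ) : Prop := ∃ M : ℝ, 0 < M ∧ ∀ n : ℕ, |u n| ≤ M ^ n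

end TensorFree

/-! Write M and C for the generating series of the moments and of the free cumulants. The heart of
the proof is the functional equation M(x) = C(x M(x)^(p/2)), in coefficient form
`Distribution.moment_eq`; the equivalence follows from it by analysis of power series.

Combinatorics. A moment is a sum of cumulants of c over pairs c ≤ b with b connected. Let r be the
component of c that contains the root. By `le_iff`, c ≤ b means that c is reached from b by a
shortest sequence of switches, each of which gains a component; hence the edges of r may be restored
in b one at a time, in any order (`toward_spec`). Restoring an edge that b lacks cuts off a
connected piece with a marked half-edge, the point where the piece was attached. Conversely, such a
piece can always be attached again: a switch between two components merges them
(`step_switch_of_not_rel`), by a parity argument based on p being even. Since cumulants are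
multiplicative over disjoint unions (`kap_glue`), each edge of r contributes an independent factor M
(`sum_extPairs_eq`). If r has k vertices it has pk/2 edges, whence the exponent. The counting is
done with labelled half-edges. Rooted maps have no automorphisms, so a sum over connected labelled
maps divided by (N-1)! is the sum over rooted unlabelled ones.

Analysis. If U(x) = V(x U(x)^q), exponential bounds pass from V to U by a bootstrap in a weighted
ℓ¹-norm (`exponentiallyBounded_of_recursion`). This gives (ii) ⇒ (i). For the converse, inverting
the substitution gives 1/C = (1/M)(x (1/C)^q) with q = p/2 (`inv_eq_subst_inv`), an equation of the
same form with C and M in reversed roles; passing to reciprocals preserves exponential bounds. -/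

namespace TensorFree

/-! ### Orbits of two permutations, one of them conjugated by a transposition -/

section Orbits

variable {H : Type}

/-- The equivalence relation generated by two permutations. -/
def orbitSetoid (σ τ : Equiv.Perm H) : Setoid H :=
  Relation.EqvGen.setoid fun x y => y = σ x ∨ y = τ x

/-- The number of orbits of the group generated by two permutations. -/
noncomputable def orbitCount (σ τ : Equiv.Perm H) : ℕ := Nat.card (Quotient (orbitSetoid σ τ))

theorem orbitSetoid_left (σ τ : Equiv.Perm H) (x : H) : orbitSetoid σ τ x (σ x) :=
  Relation.EqvGen.rel _ _ (Or.inl rfl)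

theorem orbitSetoid_right (σ τ : Equiv.Perm H) (x : H) : orbitSetoid σ τ x (τ x) :=
  Relation.EqvGen.rel _ _ (Or.inr rfl)

theorem orbitSetoid_le {σ τ : Equiv.Perm H} {s : Setoid H} (hσ : ∀ z, s z (σ z))
    (hτ : ∀ z, s z (τ z)) : orbitSetoid σ τ ≤ s := by
  refine Setoid.eqvGen_le ?_
  rintro x y (rfl | rfl)
  · exact hσ x
  · exact hτ x

theorem iff_of_orbitSetoid {σ τ : Equiv.Perm H} {P : H → Prop} (hσ : ∀ z, P z ↔ P (σ z))
    (hτ : ∀ z, P z ↔ P (τ z)) {u v : H} (h : orbitSetoid σ τ u v) : P u ↔ P v := by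
  have : orbitSetoid σ τ ≤ Setoid.ker P :=
    orbitSetoid_le (fun z => propext (hσ z)) (fun z => propext (hτ z))
  exact iff_of_eq (this h)

/-- The equivalence relation obtained by identifying the classes of two elements. -/
def joinPair (s : Setoid H) (x y : H) : Setoid H where
  r u v := s u v ∨ (s u x ∧ s y v) ∨ (s u y ∧ s x v)
  iseqv := by
    refine ⟨fun u => Or.inl (s.refl u), ?_, ?_⟩
    · rintro u v (h | ⟨h, h'⟩ | ⟨h, h'⟩)
      · exact Or.inl (s.symm h)
      · exact Or.inr (Or.inr ⟨s.symm h', s.symm h⟩)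
      · exact Or.inr (Or.inl ⟨s.symm h', s.symm h⟩)
    · rintro u v w (h | ⟨h, h'⟩ | ⟨h, h'⟩) (k | ⟨k, k'⟩ | ⟨k, k'⟩)
      · exact Or.inl (s.trans h k)
      · exact Or.inr (Or.inl ⟨s.trans h k, k'⟩)
      · exact Or.inr (Or.inr ⟨s.trans h k, k'⟩)
      · exact Or.inr (Or.inl ⟨h, s.trans h' k⟩)
      · exact Or.inl (s.trans h (s.trans (s.symm (s.trans h' k)) k'))
      · exact Or.inl (s.trans h k')
      · exact Or.inr (Or.inr ⟨h, s.trans h' k⟩)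
      · exact Or.inl (s.trans h k')
      · exact Or.inl (s.trans h (s.trans (s.symm (s.trans h' k)) k'))

theorem le_joinPair (s : Setoid H) (x y : H) : s ≤ joinPair s x y := fun _ _ h => Or.inl h

theorem joinPair_rel (s : Setoid H) (x y : H) : joinPair s x y x y :=
  Or.inr (Or.inl ⟨s.refl x, s.refl y⟩)

theorem joinPair_le {s t : Setoid H} {x y : H} (h : s ≤ t) (hxy : t x y) :
    joinPair s x y ≤ t := by
  rintro u v (k | ⟨k, k'⟩ | ⟨k, k'⟩)
  · exact h k
  · exact t.trans (h k) (t.trans hxy (h k'))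
  · exact t.trans (h k) (t.trans (t.symm hxy) (h k'))

open Classical in
theorem card_quotient_joinPair [Finite H] (s : Setoid H) (x y : H) :
    Nat.card (Quotient s) = Nat.card (Quotient (joinPair s x y)) + if s x y then 0 else 1 := by
  split_ifs with hxy
  · have : joinPair s x y = s := le_antisymm (joinPair_le le_rfl hxy) (le_joinPair s x y)
    rw [this, add_zero]
  -- The classes of `s` other than that of `y` represent the classes of the join exactly once: the
  -- class of `x` stands for the merged one.
  · rw [← Nat.card_congr (Equiv.optionSubtypeNe (Quotient.mk s y)), Finite.card_option]
    congr 1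
    let f : Quotient s → Quotient (joinPair s x y) :=
      Quotient.map' id (fun _ _ h => Or.inl h)
    refine Nat.card_congr (Equiv.ofBijective (fun q : {q // q ≠ Quotient.mk s y} => f q.1) ⟨?_, ?_⟩)
    · rintro ⟨q, hq⟩ ⟨q', hq'⟩ h
      induction q using Quotient.inductionOn with
      | h u =>
      induction q' using Quotient.inductionOn with
      | h v =>
      have hu : ¬ s u y := fun h => hq (Quotient.sound h)
      have hv : ¬ s v y := fun h => hq' (Quotient.sound h)
      have h' : joinPair s x y u v := Quotient.exact h
      rcases h' with h | ⟨_, h⟩ | ⟨h, _⟩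
      · exact Subtype.ext (Quotient.sound h)
      · exact absurd (s.symm h) hv
      · exact absurd h hu
    · intro q
      induction q using Quotient.inductionOn with
      | h u =>
      by_cases hu : s u y
      · refine ⟨⟨Quotient.mk s x, fun h => hxy (Quotient.exact h)⟩, ?_⟩
        exact Quotient.sound (Or.inr (Or.inl ⟨s.refl x, s.symm hu⟩))
      · exact ⟨⟨Quotient.mk s u, fun h => hu (Quotient.exact h)⟩, rfl⟩

open Classical in
theorem orbitSetoid_conj_le (σ τ : Equiv.Perm H) (x y : H) :
    orbitSetoid σ (Equiv.swap x y * τ * Equiv.swap x y) ≤ joinPair (orbitSetoid σ τ) x y := by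
  set s := joinPair (orbitSetoid σ τ) x y
  have hs : ∀ z, s z (Equiv.swap x y z) := by
    intro z
    rcases eq_or_ne z x with rfl | hx
    · rw [Equiv.swap_apply_left]; exact joinPair_rel _ _ _
    rcases eq_or_ne z y with rfl | hy
    · rw [Equiv.swap_apply_right]; exact s.symm (joinPair_rel _ _ _)
    rw [Equiv.swap_apply_of_ne_of_ne hx hy]
  refine orbitSetoid_le (fun z => Or.inl (orbitSetoid_left σ τ z)) fun z => ?_
  exact s.trans (hs z) (s.trans (Or.inl (orbitSetoid_right σ τ _)) (hs _))

open Classical in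
-- The inclusion `orbitSetoid_conj_le` is symmetric, because conjugating twice by the same
-- transposition is the identity. The orbit counts before and after conjugation can thus be compared
-- through one common coarser quotient.
theorem joinPair_orbitSetoid_conj (σ τ : Equiv.Perm H) (x y : H) :
    joinPair (orbitSetoid σ (Equiv.swap x y * τ * Equiv.swap x y)) x y
      = joinPair (orbitSetoid σ τ) x y := by
  have h1 := fun τ => joinPair_le (orbitSetoid_conj_le σ τ x y)
    (joinPair_rel (orbitSetoid σ τ) x y)
  refine le_antisymm (h1 τ) ?_
  have h2 := h1 (Equiv.swap x y * τ * Equiv.swap x y)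
  have h3 : Equiv.swap x y * (Equiv.swap x y * τ * Equiv.swap x y) * Equiv.swap x y = τ := by
    ext z; simp
  rwa [h3] at h2

open Classical in
/-- Exchanging two points in one of the permutations merges or splits at most one orbit. -/
theorem orbitCount_conj [Finite H] (σ τ : Equiv.Perm H) (x y : H) :
    orbitCount σ (Equiv.swap x y * τ * Equiv.swap x y) + (if orbitSetoid σ τ x y then 0 else 1)
      = orbitCount σ τ +
        if orbitSetoid σ (Equiv.swap x y * τ * Equiv.swap x y) x y then 0 else 1 := by
  have h1 := card_quotient_joinPair (orbitSetoid σ τ) x y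
  have h2 := card_quotient_joinPair (orbitSetoid σ (Equiv.swap x y * τ * Equiv.swap x y)) x y
  rw [joinPair_orbitSetoid_conj] at h2
  simp only [orbitCount]
  omega

theorem orbitCount_le_card [Finite H] (σ τ : Equiv.Perm H) : orbitCount σ τ ≤ Nat.card H :=
  Nat.card_le_card_of_surjective _ Quotient.mk_surjective

end Orbits

/-! ### Switches, and the non-crossing order as a geodesic condition -/

namespace TraceMap

variable {p : ℕ} {H : Type}

open Classical in
/-- The map obtained by exchanging the ends `x` and `y` of two edges. -/
noncomputable def switch (b : TraceMap p H) (x y : H) : TraceMap p H where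
  vert := b.vert
  edge := Equiv.swap x y * b.edge * Equiv.swap x y
  regular := b.regular
  edge_edge h := by simp [b.edge_edge]
  edge_ne h := by
    intro h'
    have := congrArg (Equiv.swap x y) h'
    simp only [Equiv.Perm.mul_apply, Equiv.swap_apply_self] at this
    exact b.edge_ne _ this

theorem isSwitch_switch (b : TraceMap p H) (x y : H) : (b.switch x y).IsSwitch b :=
  ⟨rfl, x, y, rfl⟩

theorem IsSwitch.exists_eq {c b : TraceMap p H} (h : c.IsSwitch b) : ∃ x y, c = b.switch x y := by
  obtain ⟨hv, x, y, he⟩ := h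
  exact ⟨x, y, TraceMap.ext hv he⟩

theorem switch_switch (b : TraceMap p H) (x y : H) : (b.switch x y).switch x y = b := by
  apply TraceMap.ext
  · rfl
  · ext z; simp [switch]

theorem switch_comm (b : TraceMap p H) (x y : H) : b.switch x y = b.switch y x := by
  apply TraceMap.ext
  · rfl
  · simp [switch, Equiv.swap_comm]

open Classical in
theorem numComponents_switch [Finite H] (b : TraceMap p H) (x y : H) :
    (b.switch x y).numComponents + (if b.componentSetoid x y then 0 else 1)
      = b.numComponents + if (b.switch x y).componentSetoid x y then 0 else 1 :=
  orbitCount_conj b.vert b.edge x y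

theorem componentSetoid_switch_le (b : TraceMap p H) (x y : H) :
    (b.switch x y).componentSetoid ≤ joinPair b.componentSetoid x y :=
  orbitSetoid_conj_le b.vert b.edge x y

/-- The count can only grow if `x` and `y` already lie in one component of `b`; identifying them is
then harmless, so the components of `c` refine those of `b`. -/
theorem Step.componentSetoid_le [Finite H] {c b : TraceMap p H} (h : Step c b) :
    c.componentSetoid ≤ b.componentSetoid := by
  classical
  obtain ⟨h1, h2⟩ := h
  obtain ⟨x, y, rfl⟩ := h1.exists_eq
  have h3 := b.numComponents_switch x y
  have hxy : b.componentSetoid x y := by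
    by_contra h
    rw [if_neg h] at h3
    split_ifs at h3 <;> omega
  exact (b.componentSetoid_switch_le x y).trans (joinPair_le le_rfl hxy)

theorem componentSetoid_mono [Finite H] {c b : TraceMap p H} (h : c ≤ b) :
    c.componentSetoid ≤ b.componentSetoid := by
  induction (h : Relation.ReflTransGen Step c b) with
  | refl => exact le_rfl
  | tail _ h2 ih => exact le_trans ih h2.componentSetoid_le

theorem vert_eq_of_le {c b : TraceMap p H} (h : c ≤ b) : c.vert = b.vert := by
  induction (h : Relation.ReflTransGen Step c b) with
  | refl => rfl
  | tail _ h2 ih => exact ih.trans h2.1.1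

theorem Step.le {c b : TraceMap p H} (h : Step c b) : c ≤ b := Relation.ReflTransGen.single h

/-- The number of cycles of the union of the edge matchings of two maps. -/
noncomputable def loopCount (c b : TraceMap p H) : ℕ := orbitCount c.edge b.edge

/-- The map obtained from `b` by a switch that creates the edge of `c` at `x`. -/
noncomputable def toward (c b : TraceMap p H) (x : H) : TraceMap p H :=
  b.switch (b.edge x) (c.edge x)

theorem toward_edge_self (c b : TraceMap p H) (x : H) :
    (toward c b x).edge x = c.edge x := by
  classical
  simp only [toward, switch, Equiv.Perm.mul_apply]
  rw [Equiv.swap_apply_of_ne_of_ne (b.edge_ne x).symm (c.edge_ne x).symm, Equiv.swap_apply_left]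

theorem edge_eq_symm {b : TraceMap p H} {x y : H} : b.edge x = y → b.edge y = x := by
  rintro rfl
  exact b.edge_edge x

/-- After the switch, `{x, c.edge x}` is a 2-cycle of both involutions, hence a loop of its own. It
has been split off from the loop that contained `b.edge x`. -/
theorem loopCount_toward [Finite H] {c b : TraceMap p H} {x : H} (h : b.edge x ≠ c.edge x) :
    loopCount c (toward c b x) = loopCount c b + 1 := by
  classical
  have h1 := orbitCount_conj c.edge b.edge (b.edge x) (c.edge x)
  have h2 : orbitSetoid c.edge b.edge (b.edge x) (c.edge x) :=
    Setoid.trans' _ (Setoid.symm' _ (orbitSetoid_right c.edge b.edge x)) (orbitSetoid_left c.edge b.edge x)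
  have h3 : ¬ orbitSetoid c.edge (toward c b x).edge (b.edge x) (c.edge x) := by
    intro h3
    have hx := toward_edge_self c b x
    have := iff_of_orbitSetoid (P := fun z => z = x ∨ z = c.edge x) ?_ ?_ h3
    · simp [b.edge_ne, h] at this
    · intro z
      constructor
      · rintro (rfl | rfl) <;> simp [c.edge_edge]
      · rintro (h | h)
        · right; exact (edge_eq_symm h).symm
        · left; exact c.edge.injective h
    · intro z
      constructor
      · rintro (rfl | rfl)
        · right; exact hx
        · left; exact edge_eq_symm hx
      · rintro (h | h)
        · right; rw [← hx]; exact (edge_eq_symm h).symm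
        · left; exact (toward c b x).edge.injective (h.trans hx.symm)
  rw [if_pos h2] at h1
  change _ = _ + (if orbitSetoid c.edge (toward c b x).edge (b.edge x) (c.edge x) then 0 else 1) at h1
  rw [if_neg h3] at h1
  exact h1

theorem loopCount_switch_le [Finite H] (c b : TraceMap p H) (x y : H) :
    loopCount c (b.switch x y) ≤ loopCount c b + 1 := by
  classical
  have h1 : loopCount c (b.switch x y) + _ = loopCount c b + _ := orbitCount_conj c.edge b.edge x y
  split_ifs at h1 <;> omega

theorem numComponents_switch_le [Finite H] (b : TraceMap p H) (x y : H) :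
    (b.switch x y).numComponents ≤ b.numComponents + 1 := by
  classical
  have h1 := b.numComponents_switch x y
  split_ifs at h1 <;> omega

theorem eq_of_edge_eq {c b : TraceMap p H} (hv : c.vert = b.vert) (h : ∀ x, b.edge x = c.edge x) :
    c = b :=
  TraceMap.ext hv (Equiv.ext fun x => (h x).symm)

/-- Restoring the edges of `c` one at a time gains exactly one loop and at most one component per
switch, until `b` has become `c`. The difference `loopCount c c - loopCount c b` is the length of
this path, and `le_iff` identifies `c ≤ b` with the case of equality. -/
theorem numComponents_add_loopCount_le [Finite H] {c b : TraceMap p H} (hv : c.vert = b.vert) :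
    c.numComponents + loopCount c b ≤ b.numComponents + loopCount c c := by
  induction hn : Nat.card H - loopCount c b using Nat.strong_induction_on generalizing b with
  | h n ih =>
  by_cases h : ∀ x, b.edge x = c.edge x
  · rw [eq_of_edge_eq hv h]
  · push Not at h
    obtain ⟨x, hx⟩ := h
    have h1 := loopCount_toward hx
    have h2 : loopCount c (toward c b x) ≤ Nat.card H := orbitCount_le_card _ _
    have h3 := ih _ (by omega) (b := toward c b x) hv rfl
    have h4 : (toward c b x).numComponents ≤ _ := b.numComponents_switch_le _ _
    omega

/-- A map lies on a geodesic of switches below `b` if and only if it is below `b` in the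
non-crossing order. -/
theorem le_iff [Finite H] {c b : TraceMap p H} :
    c ≤ b ↔ c.vert = b.vert ∧
      b.numComponents + loopCount c c ≤ c.numComponents + loopCount c b := by
  constructor
  · intro h
    refine ⟨vert_eq_of_le h, ?_⟩
    induction (h : Relation.ReflTransGen Step c b) with
    | refl => exact le_rfl
    | @tail _ b' _ h2 ih =>
      obtain ⟨h3, h4⟩ := h2
      obtain ⟨x, y, rfl⟩ := h3.exists_eq
      have h5 := loopCount_switch_le c b' x y
      omega
  · rintro ⟨hv, hl⟩
    induction hn : Nat.card H - loopCount c b using Nat.strong_induction_on generalizing b with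
    | h n ih =>
    by_cases h : ∀ x, b.edge x = c.edge x
    · rw [eq_of_edge_eq hv h]
    · push Not at h
      obtain ⟨x, hx⟩ := h
      have h1 := loopCount_toward hx
      have h2 : loopCount c (toward c b x) ≤ Nat.card H := orbitCount_le_card _ _
      have h4 : (toward c b x).numComponents ≤ _ := b.numComponents_switch_le _ _
      have h5 := numComponents_add_loopCount_le (b := toward c b x) hv
      have h3 := ih _ (by omega) (b := toward c b x) hv (by omega) rfl
      exact h3.trans (Step.le ⟨isSwitch_switch _ _ _,
        show (toward c b x).numComponents = _ by omega⟩)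

/-- Equality in `numComponents_add_loopCount_le` leaves no slack, so restoring any edge of `c` must
gain a component and stays above `c`. The edges can therefore be restored in any chosen order. -/
theorem toward_spec [Finite H] {c b : TraceMap p H} (h : c ≤ b) {x : H}
    (hx : b.edge x ≠ c.edge x) :
    c ≤ toward c b x ∧ (toward c b x).numComponents = b.numComponents + 1 := by
  have h0 := le_iff.1 h
  have h1 := loopCount_toward hx
  have h4 : (toward c b x).numComponents ≤ _ := b.numComponents_switch_le _ _
  have h5 := numComponents_add_loopCount_le (b := toward c b x) h0.1
  exact ⟨le_iff.2 ⟨h0.1, by omega⟩, by omega⟩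

end TraceMap
end TensorFree

/-! ### Parity: a switch between two components merges them -/

namespace TensorFree

theorem even_card_of_involution {α : Type*} (s : Finset α) (g : α → α) (hg : ∀ z ∈ s, g z ∈ s)
    (hgg : ∀ z ∈ s, g (g z) = z) (hne : ∀ z ∈ s, g z ≠ z) : Even s.card := by
  have h : ∑ _z ∈ s, (1 : ZMod 2) = 0 :=
    Finset.sum_involution (fun z _ => g z) (fun _ _ => by decide) (fun z hz _ => hne z hz) hg hgg
  rw [Finset.sum_const, nsmul_eq_mul, mul_one, ZMod.natCast_eq_zero_iff] at h
  exact even_iff_two_dvd.2 h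

theorem minimalPeriod_of_semiconj {α β : Type*} {f : α → β} (hf : Function.Injective f)
    {g : α → α} {g' : β → β} (h : Function.Semiconj f g g') (x : α) :
    Function.minimalPeriod g' (f x) = Function.minimalPeriod g x := by
  rw [Function.minimalPeriod_eq_minimalPeriod_iff]
  intro n
  have := (h.iterate_right n) x
  simp only [Function.IsPeriodicPt, Function.IsFixedPt]
  rw [← this, hf.eq_iff]

namespace TraceMap

variable {p : ℕ} {H H₁ H₂ H' H₁' H₂' : Type}

/-- As `p` is even, rotating every vertex by half a turn, `b.vert^[p / 2]`, is an involution without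
fixed points. -/
theorem even_card_of_vert_mem (hp : 2 ≤ p) (hpe : Even p) (b : TraceMap p H) (s : Finset H)
    (hs : ∀ z ∈ s, b.vert z ∈ s) : Even s.card := by
  obtain ⟨q, rfl⟩ := hpe
  have hit : ∀ n, ∀ z ∈ s, b.vert^[n] z ∈ s := by
    intro n
    induction n with
    | zero => exact fun z hz => hz
    | succ n ih => intro z hz; rw [Function.iterate_succ_apply]; exact ih _ (hs z hz)
  refine even_card_of_involution s (b.vert^[q]) (hit q) (fun z _ => ?_) fun z _ h => ?_
  · rw [← Function.iterate_add_apply]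
    have := Function.iterate_minimalPeriod (f := b.vert) (x := z)
    rwa [b.regular] at this
  · have : Function.minimalPeriod b.vert z ≤ q :=
      Function.IsPeriodicPt.minimalPeriod_le (by omega) h
    rw [b.regular] at this
    omega

/-- Exchanging the ends of two edges of different components joins these components. -/
theorem step_switch_of_not_rel [Finite H] (hp : 2 ≤ p) (hpe : Even p) (b : TraceMap p H) {x y : H}
    (h : ¬ b.componentSetoid x y) : Step b (b.switch (b.edge x) y) := by
  classical
  have := Fintype.ofFinite H
  have hxu : b.componentSetoid x (b.edge x) := orbitSetoid_right _ _ _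
  have huy : ¬ b.componentSetoid (b.edge x) y := fun h' => h (Setoid.trans' _ hxu h')
  have hxy : x ≠ y := fun h' => h (h' ▸ Setoid.refl' _ _)
  have hsw : ∀ z, (b.switch (b.edge x) y).edge z
      = Equiv.swap (b.edge x) y (b.edge (Equiv.swap (b.edge x) y z)) := fun z => by
    simp only [switch, Equiv.Perm.mul_apply]
  have hx : (b.switch (b.edge x) y).edge x = y := by
    rw [hsw, Equiv.swap_apply_of_ne_of_ne (b.edge_ne x).symm hxy, Equiv.swap_apply_left]
  -- Otherwise consider the half-edges connected to `x` both before and after the switch. They are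
  -- closed under `vert`, so their number is even; without `x` they are closed under the matching
  -- `b.edge`, so their number minus one is even too.
  have key : (b.switch (b.edge x) y).componentSetoid (b.edge x) y := by
    by_contra hc
    have hxy' : (b.switch (b.edge x) y).componentSetoid x y := by
      have := orbitSetoid_right b.vert (b.switch (b.edge x) y).edge x
      rwa [hx] at this
    set s : Finset H := Finset.univ.filter fun z =>
      b.componentSetoid x z ∧ (b.switch (b.edge x) y).componentSetoid x z with hs
    have h1 : Even s.card := by
      refine even_card_of_vert_mem hp hpe b s fun z hz => ?_
      simp only [hs, Finset.mem_filter, Finset.mem_univ, true_and] at hz ⊢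
      exact ⟨Setoid.trans' _ hz.1 (orbitSetoid_left _ _ _),
        Setoid.trans' _ hz.2 (orbitSetoid_left b.vert _ _)⟩
    have h2 : Even (s.erase x).card := by
      have hm : ∀ z ∈ s.erase x, b.edge z ∈ s.erase x := by
        intro z hz
        simp only [hs, Finset.mem_filter, Finset.mem_univ, true_and, Finset.mem_erase] at hz ⊢
        obtain ⟨hzx, hz1, hz2⟩ := hz
        have hzu : z ≠ b.edge x := by
          rintro rfl
          exact hc (Setoid.trans' _ (Setoid.symm' _ hz2) hxy')
        have hzy : z ≠ y := by
          rintro rfl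
          exact h hz1
        have hbz : b.componentSetoid x (b.edge z) := Setoid.trans' _ hz1 (orbitSetoid_right _ _ _)
        have he : (b.switch (b.edge x) y).edge z = b.edge z := by
          rw [hsw, Equiv.swap_apply_of_ne_of_ne hzu hzy, Equiv.swap_apply_of_ne_of_ne]
          · exact fun h' => hzx (b.edge.injective h')
          · rintro h'
            rw [h'] at hbz
            exact h hbz
        refine ⟨fun h' => hzu (edge_eq_symm h').symm, hbz, ?_⟩
        rw [← he]
        exact Setoid.trans' _ hz2 (orbitSetoid_right _ _ _)
      exact even_card_of_involution _ b.edge hm (fun z _ => b.edge_edge z) fun z _ => b.edge_ne z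
    have hxs : x ∈ s := by
      simp only [hs, Finset.mem_filter, Finset.mem_univ, true_and]
      exact ⟨Setoid.refl' _ _, Setoid.refl' _ _⟩
    have h3 := Finset.card_erase_add_one hxs
    rw [← h3, Nat.even_add_one] at h1
    exact h1 h2
  have h1 := b.numComponents_switch (b.edge x) y
  rw [if_neg huy, if_pos key] at h1
  refine ⟨?_, by omega⟩
  have h2 := isSwitch_switch (b.switch (b.edge x) y) (b.edge x) y
  rwa [switch_switch] at h2

/-! ### Disjoint unions, and the order below them -/

/-- The disjoint union of two maps, with half-edges named by a given decomposition. -/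
def glue (e : H₁ ⊕ H₂ ≃ H) (b₁ : TraceMap p H₁) (b₂ : TraceMap p H₂) : TraceMap p H :=
  (b₁.disjUnion b₂).relabel e

section Glue

variable (e : H₁ ⊕ H₂ ≃ H) (b₁ : TraceMap p H₁) (b₂ : TraceMap p H₂)

@[simp] theorem glue_vert_inl (z : H₁) :
    (glue e b₁ b₂).vert (e (Sum.inl z)) = e (Sum.inl (b₁.vert z)) := by
  simp [glue, relabel, disjUnion]

@[simp] theorem glue_vert_inr (z : H₂) :
    (glue e b₁ b₂).vert (e (Sum.inr z)) = e (Sum.inr (b₂.vert z)) := by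
  simp [glue, relabel, disjUnion]

@[simp] theorem glue_edge_inl (z : H₁) :
    (glue e b₁ b₂).edge (e (Sum.inl z)) = e (Sum.inl (b₁.edge z)) := by
  simp [glue, relabel, disjUnion]

@[simp] theorem glue_edge_inr (z : H₂) :
    (glue e b₁ b₂).edge (e (Sum.inr z)) = e (Sum.inr (b₂.edge z)) := by
  simp [glue, relabel, disjUnion]

end Glue

theorem orbitSetoid_sum (e : H₁ ⊕ H₂ ≃ H) {σ τ : Equiv.Perm H} {σ₁ τ₁ : Equiv.Perm H₁}
    {σ₂ τ₂ : Equiv.Perm H₂} (h1 : ∀ z, σ (e (Sum.inl z)) = e (Sum.inl (σ₁ z)))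
    (h2 : ∀ z, σ (e (Sum.inr z)) = e (Sum.inr (σ₂ z)))
    (h3 : ∀ z, τ (e (Sum.inl z)) = e (Sum.inl (τ₁ z)))
    (h4 : ∀ z, τ (e (Sum.inr z)) = e (Sum.inr (τ₂ z))) :
    orbitSetoid σ τ = Setoid.ker fun u => Sum.map (Quotient.mk (orbitSetoid σ₁ τ₁))
      (Quotient.mk (orbitSetoid σ₂ τ₂)) (e.symm u) := by
  refine le_antisymm (orbitSetoid_le ?_ ?_) ?_
  · intro z
    obtain ⟨z | z, rfl⟩ := e.surjective z
    · rw [h1, Setoid.ker_def]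
      simp only [Equiv.symm_apply_apply, Sum.map_inl]
      exact congrArg _ (Quotient.sound (orbitSetoid_left _ _ _))
    · rw [h2, Setoid.ker_def]
      simp only [Equiv.symm_apply_apply, Sum.map_inr]
      exact congrArg _ (Quotient.sound (orbitSetoid_left _ _ _))
  · intro z
    obtain ⟨z | z, rfl⟩ := e.surjective z
    · rw [h3, Setoid.ker_def]
      simp only [Equiv.symm_apply_apply, Sum.map_inl]
      exact congrArg _ (Quotient.sound (orbitSetoid_right _ _ _))
    · rw [h4, Setoid.ker_def]
      simp only [Equiv.symm_apply_apply, Sum.map_inr]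
      exact congrArg _ (Quotient.sound (orbitSetoid_right _ _ _))
  · have k1 : orbitSetoid σ₁ τ₁ ≤ (orbitSetoid σ τ).comap (fun z => e (Sum.inl z)) :=
      orbitSetoid_le (fun z => by rw [Setoid.comap_rel, ← h1]; exact orbitSetoid_left _ _ _)
        (fun z => by rw [Setoid.comap_rel, ← h3]; exact orbitSetoid_right _ _ _)
    have k2 : orbitSetoid σ₂ τ₂ ≤ (orbitSetoid σ τ).comap (fun z => e (Sum.inr z)) :=
      orbitSetoid_le (fun z => by rw [Setoid.comap_rel, ← h2]; exact orbitSetoid_left _ _ _)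
        (fun z => by rw [Setoid.comap_rel, ← h4]; exact orbitSetoid_right _ _ _)
    intro u v h
    obtain ⟨u, rfl⟩ := e.surjective u
    obtain ⟨v, rfl⟩ := e.surjective v
    rw [Setoid.ker_def] at h
    simp only [Equiv.symm_apply_apply] at h
    rcases u with u | u <;> rcases v with v | v <;> simp at h
    · exact k1 (Quotient.exact h)
    · exact k2 (Quotient.exact h)

theorem orbitCount_sum [Finite H] (e : H₁ ⊕ H₂ ≃ H) {σ τ : Equiv.Perm H} {σ₁ τ₁ : Equiv.Perm H₁}
    {σ₂ τ₂ : Equiv.Perm H₂} (h1 : ∀ z, σ (e (Sum.inl z)) = e (Sum.inl (σ₁ z)))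
    (h2 : ∀ z, σ (e (Sum.inr z)) = e (Sum.inr (σ₂ z)))
    (h3 : ∀ z, τ (e (Sum.inl z)) = e (Sum.inl (τ₁ z)))
    (h4 : ∀ z, τ (e (Sum.inr z)) = e (Sum.inr (τ₂ z))) :
    orbitCount σ τ = orbitCount σ₁ τ₁ + orbitCount σ₂ τ₂ := by
  have : Finite H₁ := Finite.of_injective (fun z => e (Sum.inl z)) (e.injective.comp Sum.inl_injective)
  have : Finite H₂ := Finite.of_injective (fun z => e (Sum.inr z)) (e.injective.comp Sum.inr_injective)
  rw [orbitCount, orbitSetoid_sum e h1 h2 h3 h4, orbitCount, orbitCount, ← Nat.card_sum]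
  refine Nat.card_congr (Setoid.quotientKerEquivOfSurjective _ ?_)
  exact (Sum.map_surjective.2 ⟨Quotient.mk_surjective, Quotient.mk_surjective⟩).comp
    e.symm.surjective

section Glue

variable (e : H₁ ⊕ H₂ ≃ H) {b₁ c₁ : TraceMap p H₁} {b₂ c₂ : TraceMap p H₂}

theorem componentSetoid_glue_inl (x : H₁) (v : H) : (glue e b₁ b₂).componentSetoid (e (Sum.inl x)) v
    ↔ ∃ z, v = e (Sum.inl z) ∧ b₁.componentSetoid x z := by
  have : (glue e b₁ b₂).componentSetoid = _ :=
    orbitSetoid_sum e (σ₁ := b₁.vert) (σ₂ := b₂.vert) (τ₁ := b₁.edge) (τ₂ := b₂.edge)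
      (by simp) (by simp) (by simp) (by simp)
  rw [this, Setoid.ker_def]
  obtain ⟨v, rfl⟩ := e.surjective v
  rcases v with v | v
  · simp only [Equiv.symm_apply_apply, Sum.map_inl, Sum.inl.injEq, EmbeddingLike.apply_eq_iff_eq,
      exists_eq_left']
    exact Quotient.eq
  · simp

theorem glue_injective (h : glue e b₁ b₂ = glue e c₁ c₂) : b₁ = c₁ ∧ b₂ = c₂ := by
  constructor
  · apply TraceMap.ext <;> ext z
    · have := DFunLike.congr_fun (congrArg vert h) (e (Sum.inl z)); simpa using this
    · have := DFunLike.congr_fun (congrArg edge h) (e (Sum.inl z)); simpa using this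
  · apply TraceMap.ext <;> ext z
    · have := DFunLike.congr_fun (congrArg vert h) (e (Sum.inr z)); simpa using this
    · have := DFunLike.congr_fun (congrArg edge h) (e (Sum.inr z)); simpa using this

variable [Finite H]

theorem numComponents_glue :
    (glue e b₁ b₂).numComponents = b₁.numComponents + b₂.numComponents :=
  orbitCount_sum e (by simp) (by simp) (by simp) (by simp)

theorem loopCount_glue :
    loopCount (glue e c₁ c₂) (glue e b₁ b₂) = loopCount c₁ b₁ + loopCount c₂ b₂ :=
  orbitCount_sum e (by simp) (by simp) (by simp) (by simp)

/-- Component and loop counts are additive, and the defect in `numComponents_add_loopCount_le` is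
nonnegative on each side; it vanishes for the union exactly when it vanishes for both parts. -/
theorem glue_le_glue_iff : glue e c₁ c₂ ≤ glue e b₁ b₂ ↔ c₁ ≤ b₁ ∧ c₂ ≤ b₂ := by
  have : Finite H₁ := Finite.of_injective (fun z => e (Sum.inl z)) (e.injective.comp Sum.inl_injective)
  have : Finite H₂ := Finite.of_injective (fun z => e (Sum.inr z)) (e.injective.comp Sum.inr_injective)
  rw [le_iff, le_iff, le_iff, numComponents_glue, numComponents_glue, loopCount_glue, loopCount_glue]
  have hv : (glue e c₁ c₂).vert = (glue e b₁ b₂).vert ↔ c₁.vert = b₁.vert ∧ c₂.vert = b₂.vert := by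
    constructor
    · intro h
      constructor <;> ext z
      · have := DFunLike.congr_fun h (e (Sum.inl z)); simpa using this
      · have := DFunLike.congr_fun h (e (Sum.inr z)); simpa using this
    · rintro ⟨h, h'⟩
      simp [glue, relabel, disjUnion, h, h']
  rw [hv]
  constructor
  · rintro ⟨⟨hv1, hv2⟩, h⟩
    have h1 := numComponents_add_loopCount_le hv1
    have h2 := numComponents_add_loopCount_le hv2
    exact ⟨⟨hv1, by omega⟩, hv2, by omega⟩
  · rintro ⟨⟨hv1, h1⟩, hv2, h2⟩
    exact ⟨⟨hv1, hv2⟩, by omega⟩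

theorem exists_sumCongr (σ : Equiv.Perm H) (h : ∀ z, ∃ w, σ (e (Sum.inl z)) = e (Sum.inl w)) :
    ∃ (σ₁ : Equiv.Perm H₁) (σ₂ : Equiv.Perm H₂), σ = e.permCongr (Equiv.sumCongr σ₁ σ₂) := by
  have : Finite H₁ := Finite.of_injective (fun z => e (Sum.inl z)) (e.injective.comp Sum.inl_injective)
  have : Finite H₂ := Finite.of_injective (fun z => e (Sum.inr z)) (e.injective.comp Sum.inr_injective)
  have h1 : e.symm.permCongr σ ∈ (Equiv.Perm.sumCongrHom H₁ H₂).range := by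
    apply Equiv.Perm.mem_sumCongrHom_range_of_perm_mapsTo_inl
    rintro _ ⟨z, rfl⟩
    obtain ⟨w, hw⟩ := h z
    exact ⟨w, by simp [hw]⟩
  obtain ⟨⟨σ₁, σ₂⟩, h2⟩ := h1
  refine ⟨σ₁, σ₂, ?_⟩
  change _ = e.permCongr (Equiv.Perm.sumCongrHom H₁ H₂ (σ₁, σ₂))
  rw [h2]
  ext z; simp

theorem exists_eq_glue (b : TraceMap p H) (hv : ∀ z, ∃ w, b.vert (e (Sum.inl z)) = e (Sum.inl w))
    (he : ∀ z, ∃ w, b.edge (e (Sum.inl z)) = e (Sum.inl w)) :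
    ∃ (b₁ : TraceMap p H₁) (b₂ : TraceMap p H₂), b = glue e b₁ b₂ := by
  obtain ⟨σ₁, σ₂, hσ⟩ := exists_sumCongr e b.vert hv
  obtain ⟨τ₁, τ₂, hτ⟩ := exists_sumCongr e b.edge he
  have i1 : Function.Injective (fun z => e (Sum.inl z)) := e.injective.comp Sum.inl_injective
  have i2 : Function.Injective (fun z => e (Sum.inr z)) := e.injective.comp Sum.inr_injective
  refine ⟨⟨σ₁, τ₁, fun z => ?_, fun z => ?_, fun z h => ?_⟩,
    ⟨σ₂, τ₂, fun z => ?_, fun z => ?_, fun z h => ?_⟩, TraceMap.ext hσ hτ⟩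
  · rw [← b.regular (e (Sum.inl z))]
    exact (minimalPeriod_of_semiconj i1 (fun z => by simp [hσ]) z).symm
  · have := b.edge_edge (e (Sum.inl z)); simpa [hτ] using this
  · exact b.edge_ne (e (Sum.inl z)) (by simp [hτ, h])
  · rw [← b.regular (e (Sum.inr z))]
    exact (minimalPeriod_of_semiconj i2 (fun z => by simp [hσ]) z).symm
  · have := b.edge_edge (e (Sum.inr z)); simpa [hτ] using this
  · exact b.edge_ne (e (Sum.inr z)) (by simp [hτ, h])

end Glue

theorem disjUnion_relabel (b₁ : TraceMap p H₁) (b₂ : TraceMap p H₂) (e₁ : H₁ ≃ H₁') (e₂ : H₂ ≃ H₂') :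
    (b₁.disjUnion b₂).relabel (e₁.sumCongr e₂) = (b₁.relabel e₁).disjUnion (b₂.relabel e₂) := by
  apply TraceMap.ext <;> ext (z | z) <;> simp [relabel, disjUnion]

theorem le_relabel_iff (c b : TraceMap p H) (e : H ≃ H') : c.relabel e ≤ b.relabel e ↔ c ≤ b := by
  have key : ∀ {H H' : Type} (c b : TraceMap p H) (e : H ≃ H'), c ≤ b →
      c.relabel e ≤ b.relabel e := by
    intro H H' c b e h
    rcases eq_or_lt_of_le h with rfl | h
    · exact le_rfl
    · exact (lt_relabel h e).le
  refine ⟨fun h => ?_, key c b e⟩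
  have := key _ _ e.symm h
  simpa [relabel_trans, relabel_refl] using this

/-- Components only get finer when going down in the order, so the decomposition is inherited by
every smaller map. With `glue_le_glue_iff`, the lower set of a disjoint union is a product of lower
sets. -/
theorem exists_glue_of_le_glue [Finite H] (e : H₁ ⊕ H₂ ≃ H) {c : TraceMap p H} {b₁ : TraceMap p H₁}
    {b₂ : TraceMap p H₂} (h : c ≤ glue e b₁ b₂) :
    ∃ c₁ c₂, c₁ ≤ b₁ ∧ c₂ ≤ b₂ ∧ c = glue e c₁ c₂ := by
  have hm := componentSetoid_mono h
  obtain ⟨c₁, c₂, rfl⟩ := exists_eq_glue e c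
    (fun z => by
      obtain ⟨w, hw, _⟩ := (componentSetoid_glue_inl e z _).1 (hm (orbitSetoid_left c.vert c.edge _))
      exact ⟨w, hw⟩)
    (fun z => by
      obtain ⟨w, hw, _⟩ := (componentSetoid_glue_inl e z _).1 (hm (orbitSetoid_right c.vert c.edge _))
      exact ⟨w, hw⟩)
  rw [glue_le_glue_iff] at h
  exact ⟨c₁, c₂, h.1, h.2, rfl⟩

/-- Relabelling as a bijection. -/
@[simps] def relabelEquiv (e : H ≃ H') : TraceMap p H ≃ TraceMap p H' where
  toFun b := b.relabel e
  invFun b := b.relabel e.symm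
  left_inv b := by dsimp only; rw [relabel_trans, Equiv.self_trans_symm, relabel_refl]
  right_inv b := by dsimp only; rw [relabel_trans, Equiv.symm_trans_self, relabel_refl]

end TraceMap

/-! ### Multiplicativity of the free cumulants -/

namespace Distribution

open TraceMap

variable {p : ℕ} (a : Distribution p) {H H₁ H₂ H' : Type}

/-- The value of a distribution on a map with an arbitrary finite set of half-edges. -/
noncomputable def ev [Finite H] (b : TraceMap p H) : ℝ := a.val (b.relabel (Finite.equivFin H))

/-- The free cumulant of a map with an arbitrary finite set of half-edges. -/
noncomputable def kap [Finite H] (b : TraceMap p H) : ℝ :=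
  a.mapCumulant (b.relabel (Finite.equivFin H))

theorem ev_eq [Finite H] (b : TraceMap p H) {m : ℕ} (e : H ≃ Fin m) :
    a.ev b = a.val (b.relabel e) := by
  obtain rfl : Nat.card H = m := by rw [Nat.card_congr e, Nat.card_fin]
  rw [ev, ← a.val_relabel ((Finite.equivFin H).symm.trans e), relabel_trans, ← Equiv.trans_assoc,
    Equiv.self_trans_symm, Equiv.refl_trans]

theorem kap_eq [Finite H] (b : TraceMap p H) {m : ℕ} (e : H ≃ Fin m) :
    a.kap b = a.mapCumulant (b.relabel e) := by
  obtain rfl : Nat.card H = m := by rw [Nat.card_congr e, Nat.card_fin]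
  rw [kap, ← a.mapCumulant_relabel ((Finite.equivFin H).symm.trans e), relabel_trans,
    ← Equiv.trans_assoc, Equiv.self_trans_symm, Equiv.refl_trans]

theorem ev_relabel [Finite H] [Finite H'] (b : TraceMap p H) (e : H ≃ H') :
    a.ev (b.relabel e) = a.ev b := by
  rw [a.ev_eq b (e.trans (Finite.equivFin H')), ← relabel_trans, ev]

theorem kap_relabel [Finite H] [Finite H'] (b : TraceMap p H) (e : H ≃ H') :
    a.kap (b.relabel e) = a.kap b := by
  rw [a.kap_eq b (e.trans (Finite.equivFin H')), ← relabel_trans, kap]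

theorem ev_fin {m : ℕ} (b : TraceMap p (Fin m)) : a.ev b = a.val b := by
  rw [a.ev_eq b (Equiv.refl _), relabel_refl]

theorem kap_fin {m : ℕ} (b : TraceMap p (Fin m)) : a.kap b = a.mapCumulant b := by
  rw [a.kap_eq b (Equiv.refl _), relabel_refl]

theorem ev_glue [Finite H] [Finite H₁] [Finite H₂] (e : H₁ ⊕ H₂ ≃ H) (b₁ : TraceMap p H₁)
    (b₂ : TraceMap p H₂) : a.ev (glue e b₁ b₂) = a.ev b₁ * a.ev b₂ := by
  rw [glue, ev_relabel, a.ev_eq _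
    (((Finite.equivFin H₁).sumCongr (Finite.equivFin H₂)).trans finSumFinEquiv), ← relabel_trans,
    disjUnion_relabel, a.val_disjUnion, ev, ev]

open Classical in
theorem ev_eq_sum [Finite H] (b : TraceMap p H) :
    a.ev b = ∑ c : TraceMap p H with c ≤ b, a.kap c := by
  rw [ev, a.sum_mapCumulant]
  symm
  refine Finset.sum_equiv (relabelEquiv (Finite.equivFin H)) (fun c => ?_) (fun c _ => rfl)
  simp [le_relabel_iff]

open Classical in
theorem sum_le_glue [Finite H] [Finite H₁] [Finite H₂] (e : H₁ ⊕ H₂ ≃ H) (f : TraceMap p H → ℝ)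
    (b : TraceMap p H₁ × TraceMap p H₂) :
    ∑ c : TraceMap p H with c ≤ glue e b.1 b.2, f c
      = ∑ c : TraceMap p H₁ × TraceMap p H₂ with c ≤ b, f (glue e c.1 c.2) := by
  symm
  refine Finset.sum_bij (fun c _ => glue e c.1 c.2) ?_ ?_ ?_ (fun _ _ => rfl)
  · intro c hc
    simpa [glue_le_glue_iff, Prod.le_def] using hc
  · intro c _ d _ h
    exact Prod.ext_iff.2 (glue_injective e h)
  · intro c hc
    simp only [Finset.mem_filter, Finset.mem_univ, true_and] at hc
    obtain ⟨c₁, c₂, h1, h2, rfl⟩ := exists_glue_of_le_glue e hc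
    exact ⟨(c₁, c₂), by simpa using ⟨h1, h2⟩, rfl⟩

/-- Since lower sets of disjoint unions are products, both sides solve the same triangular system
over the product order, whose left-hand side factors by multiplicativity of `a`. -/
theorem kap_glue [Finite H] [Finite H₁] [Finite H₂] (e : H₁ ⊕ H₂ ≃ H) (b₁ : TraceMap p H₁)
    (b₂ : TraceMap p H₂) : a.kap (glue e b₁ b₂) = a.kap b₁ * a.kap b₂ := by
  classical
  suffices h : ∀ b : TraceMap p H₁ × TraceMap p H₂,
      a.kap (glue e b.1 b.2) = a.kap b.1 * a.kap b.2 from h (b₁, b₂)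
  intro b
  induction b using WellFoundedLT.induction with
  | ind b ih =>
    have h1 : (Finset.univ.filter fun c : TraceMap p H₁ × TraceMap p H₂ => c ≤ b)
        = insert b (Finset.univ.filter fun c => c < b) := by
      ext c
      simp [le_iff_eq_or_lt]
    have h2 := a.ev_glue e b.1 b.2
    rw [ev_eq_sum, sum_le_glue, ev_eq_sum, ev_eq_sum, Finset.sum_mul_sum, ← Finset.sum_product'] at h2
    have h3 : (Finset.univ.filter fun c : TraceMap p H₁ => c ≤ b.1) ×ˢ
        (Finset.univ.filter fun c : TraceMap p H₂ => c ≤ b.2)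
        = Finset.univ.filter fun c : TraceMap p H₁ × TraceMap p H₂ => c ≤ b := by
      ext c; simp [Prod.le_def]
    rw [h3, h1, Finset.sum_insert (by simp), Finset.sum_insert (by simp),
      Finset.sum_congr rfl (fun c hc => ih c (by simpa using hc))] at h2
    exact add_right_cancel h2

end Distribution
end TensorFree

/-! ### Surgery: cutting a connected map at one edge of the smaller map -/

namespace TensorFree

namespace TraceMap

variable {p : ℕ} {H R : Type}

theorem switch_edge_of_ne (b : TraceMap p H) {x y z : H} (h1 : z ≠ x) (h2 : z ≠ y)
    (h3 : b.edge z ≠ x) (h4 : b.edge z ≠ y) : (b.switch x y).edge z = b.edge z := by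
  classical
  simp only [switch, Equiv.Perm.mul_apply]
  rw [Equiv.swap_apply_of_ne_of_ne h1 h2, Equiv.swap_apply_of_ne_of_ne h3 h4]

theorem switch_edge_self (b : TraceMap p H) {x y : H} (h : x ≠ y) :
    (b.switch (b.edge x) y).edge x = y := by
  classical
  simp only [switch, Equiv.Perm.mul_apply]
  rw [Equiv.swap_apply_of_ne_of_ne (b.edge_ne x).symm h, Equiv.swap_apply_left]

theorem IsConnected.rel {b : TraceMap p H} (h : b.IsConnected) (x y : H) :
    b.componentSetoid x y := by
  have := (Nat.card_eq_one_iff_unique.1 (h : Nat.card (Quotient b.componentSetoid) = 1)).1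
  exact Quotient.exact (Subsingleton.elim (Quotient.mk b.componentSetoid x) (Quotient.mk _ y))

theorem IsConnected.nonempty {b : TraceMap p H} (h : b.IsConnected) : Nonempty H := by
  obtain ⟨⟨q⟩⟩ := (Nat.card_eq_one_iff_unique.1 (h : Nat.card (Quotient b.componentSetoid) = 1)).2
  exact ⟨q⟩

theorem isConnected_of_rel {b : TraceMap p H} (x : H) (h : ∀ y, b.componentSetoid x y) :
    b.IsConnected := by
  change Nat.card (Quotient b.componentSetoid) = 1
  rw [Nat.card_eq_one_iff_unique]
  refine ⟨⟨fun q q' => ?_⟩, ⟨Quotient.mk _ x⟩⟩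
  induction q using Quotient.inductionOn
  induction q' using Quotient.inductionOn
  exact Quotient.sound (Setoid.trans' _ (Setoid.symm' _ (h _)) (h _))

theorem numComponents_pos [Finite H] (b : TraceMap p H) (x : H) : 0 < b.numComponents :=
  have : Nonempty (Quotient b.componentSetoid) := ⟨Quotient.mk _ x⟩
  Nat.card_pos

/-- The switch must separate `b.edge x` from `c.edge x` to gain a component, and `x` stays attached
to `c.edge x`. -/
theorem toward_not_rel [Finite H] {c b : TraceMap p H} (h : c ≤ b) {x : H}
    (hx : b.edge x ≠ c.edge x) : ¬ (toward c b x).componentSetoid x (b.edge x) := by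
  classical
  intro hc
  have h1 := (toward_spec h hx).2
  have h2 : (toward c b x).numComponents + _ = _ + _ := b.numComponents_switch (b.edge x) (c.edge x)
  have h3 : (b.switch (b.edge x) (c.edge x)).componentSetoid (b.edge x) (c.edge x) := by
    refine Setoid.trans' _ (Setoid.symm' _ hc) ?_
    have := orbitSetoid_right b.vert (toward c b x).edge x
    rwa [toward_edge_self c b x] at this
  rw [if_pos h3] at h2
  omega

/-- The map `c` restricts to `r` along the injection `i` of sets of half-edges. -/
def Extends (r : TraceMap p R) (i : R → H) (c : TraceMap p H) : Prop :=
  (∀ z, c.vert (i z) = i (r.vert z)) ∧ ∀ z, c.edge (i z) = i (r.edge z)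

theorem Extends.rel {r : TraceMap p R} {i : R → H} {c : TraceMap p H} (h : Extends r i c)
    {z w : R} (hr : r.componentSetoid z w) : c.componentSetoid (i z) (i w) := by
  have : r.componentSetoid ≤ c.componentSetoid.comap i :=
    orbitSetoid_le (fun z => by rw [Setoid.comap_rel, ← h.1]; exact orbitSetoid_left _ _ _)
      (fun z => by rw [Setoid.comap_rel, ← h.2]; exact orbitSetoid_right _ _ _)
  exact this hr

theorem Extends.mem_range_iff {r : TraceMap p R} {i : R → H} {c : TraceMap p H}
    (h : Extends r i c) {x y : H} (hxy : c.componentSetoid x y) :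
    x ∈ Set.range i ↔ y ∈ Set.range i := by
  have hinv : ∀ (σ : Equiv.Perm H) (σ' : Equiv.Perm R), (∀ z, σ (i z) = i (σ' z)) →
      ∀ z, z ∈ Set.range i ↔ σ z ∈ Set.range i := by
    intro σ σ' h z
    constructor
    · rintro ⟨w, rfl⟩
      exact ⟨σ' w, (h w).symm⟩
    · rintro ⟨w, hw⟩
      refine ⟨σ'.symm w, σ.injective ?_⟩
      rw [h, Equiv.apply_symm_apply, hw]
  exact iff_of_orbitSetoid (P := fun z => z ∈ Set.range i) (hinv _ _ h.1) (hinv _ _ h.2) hxy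

open Classical in
/-- The connected maps together with a map below them in the non-crossing order. -/
noncomputable def connPairs (p : ℕ) (H : Type) [Finite H] :
    Finset (TraceMap p H × TraceMap p H) :=
  Finset.univ.filter fun q => q.1 ≤ q.2 ∧ q.2.IsConnected

open Classical in
/-- The pairs of maps `c ≤ b` with `b` connected such that `c` extends `r` and the edges of `r` at
`F` are edges of `b`. -/
noncomputable def extPairs [Finite H] (r : TraceMap p R) (i : R → H) (F : Set R) :
    Finset (TraceMap p H × TraceMap p H) :=
  (connPairs p H).filter fun q => Extends r i q.1 ∧ ∀ z ∈ F, q.2.edge (i z) = i (r.edge z)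

theorem mem_connPairs [Finite H] {q : TraceMap p H × TraceMap p H} :
    q ∈ connPairs p H ↔ q.1 ≤ q.2 ∧ q.2.IsConnected := by
  simp [connPairs]

theorem mem_extPairs [Finite H] {r : TraceMap p R} {i : R → H} {F : Set R}
    {q : TraceMap p H × TraceMap p H} : q ∈ extPairs r i F ↔ (q.1 ≤ q.2 ∧ q.2.IsConnected) ∧
      Extends r i q.1 ∧ ∀ z ∈ F, q.2.edge (i z) = i (r.edge z) := by
  simp [extPairs, mem_connPairs]

open Classical in
/-- The component of `x` after the edge of `c` at `x` has been restored in `b`. -/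
noncomputable def cutComponent [Finite H] (x : H) (q : TraceMap p H × TraceMap p H) : Finset H :=
  have := Fintype.ofFinite H
  Finset.univ.filter fun h => (toward q.1 q.2 x).componentSetoid x h

theorem mem_cutComponent [Finite H] {x h : H} {q : TraceMap p H × TraceMap p H} :
    h ∈ cutComponent x q ↔ (toward q.1 q.2 x).componentSetoid x h := by
  simp [cutComponent]

open Classical in
/-- The pairs in `extPairs r i F` for which the edge of `r` at `x` is not an edge of the larger
map, and is cut off with the component `S`. -/
noncomputable def cutPairs [Finite H] (r : TraceMap p R) (i : R → H) (F : Set R) (x : R)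
    (S : Finset H) : Finset (TraceMap p H × TraceMap p H) :=
  (extPairs r i F).filter fun q =>
    q.2.edge (i x) ≠ i (r.edge x) ∧ cutComponent (i x) q = S

/-- This undoes `toward`: the edge of `c` at `x` is opened and `x` is tied to `y` in the other
component. The result still lies above `c` because the merging switch is a `Step`. -/
theorem join_spec [Finite H] (hp : 2 ≤ p) (hpe : Even p) {c b : TraceMap p H} (h : c ≤ b)
    (hb : b.numComponents = 2) {x y : H} (hx : b.edge x = c.edge x)
    (hxy : ¬ b.componentSetoid x y) : c ≤ b.switch (c.edge x) y ∧
      (b.switch (c.edge x) y).IsConnected ∧ (b.switch (c.edge x) y).edge x = y ∧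
      toward c (b.switch (c.edge x) y) x = b := by
  rw [← hx]
  have h1 := step_switch_of_not_rel hp hpe b hxy
  have h2 : (b.switch (b.edge x) y).edge x = y :=
    b.switch_edge_self fun h => hxy (h ▸ Setoid.refl' _ _)
  refine ⟨h.trans h1.le, ?_, h2, ?_⟩
  · have := h1.2
    rw [hb] at this
    exact (Nat.succ_injective this).symm
  · rw [toward, h2, ← hx, switch_comm, switch_switch]

theorem toward_edge_of_eq {c b : TraceMap p H} {x z : H} (hx : b.edge x ≠ c.edge x)
    (hz : b.edge z = c.edge z) : (toward c b x).edge z = c.edge z := by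
  rcases eq_or_ne z x with rfl | hzx
  · exact toward_edge_self c b z
  rw [toward, switch_edge_of_ne, hz]
  · rintro rfl
    rw [b.edge_edge] at hz
    exact hx (edge_eq_symm hz.symm).symm
  · rintro rfl
    rw [c.edge_edge] at hz
    exact hx (edge_eq_symm hz)
  · exact fun h => hzx (b.edge.injective h)
  · rw [hz]; exact fun h => hzx (c.edge.injective h)

section Surgery

variable [Finite H] {r : TraceMap p R} {i : R → H} {F : Set R} {x : R}

theorem cutPairs_subset (hr : r.IsConnected) {S : Finset H} {q : TraceMap p H × TraceMap p H}
    (hq : q ∈ cutPairs r i F x S) : (∀ z, i z ∈ S) ∧ q.2.edge (i x) ∉ S := by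
  simp only [cutPairs, Finset.mem_filter, mem_extPairs] at hq
  obtain ⟨⟨⟨hle, hconn⟩, hext, hF⟩, hx, rfl⟩ := hq
  rw [← hext.2] at hx
  refine ⟨fun z => ?_, ?_⟩
  · rw [mem_cutComponent]
    exact componentSetoid_mono (toward_spec hle hx).1 (hext.rel (hr.rel x z))
  · rw [mem_cutComponent]
    exact toward_not_rel hle hx

open Classical in
-- Cutting is a bijection: a pair that is cut along `S` corresponds to a pair on `S` in which the
-- edge at `x` is shared, a connected pair on the complement, and the half-edge `y` of the
-- complement to which `x` was tied. The choice of `y` gives the cardinality factor, and `kap_glue`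
-- splits the weight.
theorem sum_cutPairs (hp : 2 ≤ p) (hpe : Even p) (a : Distribution p) (hr : r.IsConnected) (hi : Function.Injective i)
    (hxF : x ∉ F) (hxF' : r.edge x ∉ F) {S : Finset H} (hS : ∀ z, i z ∈ S) :
    ∑ q ∈ cutPairs r i F x S, a.kap q.1
      = (∑ q ∈ extPairs r (fun z => (⟨i z, hS z⟩ : {h // h ∈ S})) (insert x (insert (r.edge x) F)),
          a.kap q.1) * (Nat.card {h // ¬ h ∈ S} * ∑ q ∈ connPairs p {h // ¬ h ∈ S}, a.kap q.1) := by
  have := Fintype.ofFinite H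
  set e := Equiv.sumCompl (· ∈ S) with he
  set F' := insert x (insert (r.edge x) F) with hF'
  set j : R → {h // h ∈ S} := fun z => ⟨i z, hS z⟩ with hj
  have hej : ∀ z, e (Sum.inl (j z)) = i z := fun z => rfl
  have hw : ∀ w : {h // h ∈ S}, e (Sum.inl w) = (w : H) := fun z => rfl
  -- The inverse construction, by `join_spec`. The edges at `F` survive the switch, since it only
  -- touches the edges at `i (r.edge x)` and at `y`.
  have key : ∀ (q₁ : TraceMap p {h // h ∈ S} × TraceMap p {h // h ∈ S})
      (q₂ : TraceMap p {h // ¬ h ∈ S} × TraceMap p {h // ¬ h ∈ S}) (y : {h // ¬ h ∈ S}),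
      q₁ ∈ extPairs r j F' → q₂ ∈ connPairs p {h // ¬ h ∈ S} →
      glue e q₁.1 q₂.1 ≤ (glue e q₁.2 q₂.2).switch (i (r.edge x)) y ∧
      ((glue e q₁.2 q₂.2).switch (i (r.edge x)) y).IsConnected ∧
      ((glue e q₁.2 q₂.2).switch (i (r.edge x)) y).edge (i x) = y ∧
      toward (glue e q₁.1 q₂.1) ((glue e q₁.2 q₂.2).switch (i (r.edge x)) y) (i x)
        = glue e q₁.2 q₂.2 ∧
      ∀ z ∈ F, ((glue e q₁.2 q₂.2).switch (i (r.edge x)) y).edge (i z) = i (r.edge z) := by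
    intro q₁ q₂ y h1 h2
    rw [mem_extPairs] at h1
    rw [mem_connPairs] at h2
    obtain ⟨⟨h1, h1'⟩, ⟨hv1, he1⟩, hF1⟩ := h1
    have hc : (glue e q₁.1 q₂.1).edge (i x) = i (r.edge x) := by
      rw [← hej, glue_edge_inl, he1, hej]
    have hb : ∀ z ∈ F', (glue e q₁.2 q₂.2).edge (i z) = i (r.edge z) := by
      intro z hz
      rw [← hej, glue_edge_inl, hF1 z hz, hej]
    have hnr : ¬ (glue e q₁.2 q₂.2).componentSetoid (i x) y := by
      rw [← hej, componentSetoid_glue_inl]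
      rintro ⟨z, hz, _⟩
      rw [hw] at hz
      exact y.2 (hz ▸ z.2)
    rw [← hc]
    have hbc : (glue e q₁.2 q₂.2).edge (i x) = (glue e q₁.1 q₂.1).edge (i x) := by
      rw [hb x (by simp [hF']), hc]
    obtain ⟨k1, k2, k3, k4⟩ := join_spec hp hpe ((glue_le_glue_iff e).2 ⟨h1, h2.1⟩)
      (by rw [numComponents_glue, h1', h2.2]) hbc hnr
    refine ⟨k1, k2, k3, k4, fun z hz => ?_⟩
    have hzx : z ≠ x := fun h => hxF (h ▸ hz)
    have hzx' : z ≠ r.edge x := fun h => hxF' (h ▸ hz)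
    have hiy : ∀ z, i z ≠ y := fun z h => y.2 (h ▸ hS z)
    have hbz := hb z (by simp [hF', hz])
    rw [switch_edge_of_ne, hbz]
    · rw [hc]; exact fun h => hzx' (hi h)
    · exact hiy z
    · rw [hbz, hc]; exact fun h => hzx (r.edge.injective (hi h))
    · rw [hbz]; exact hiy _
  have hsum : (∑ q ∈ extPairs r j F', a.kap q.1) *
      (Nat.card {h // ¬ h ∈ S} * ∑ q ∈ connPairs p {h // ¬ h ∈ S}, a.kap q.1)
      = ∑ t ∈ extPairs r j F' ×ˢ ((Finset.univ : Finset {h // ¬ h ∈ S}) ×ˢ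
          connPairs p {h // ¬ h ∈ S}), a.kap t.1.1 * a.kap t.2.2.1 := by
    rw [Finset.sum_product, Finset.sum_mul]
    refine Finset.sum_congr rfl fun q _ => ?_
    rw [Finset.sum_product]
    dsimp only
    rw [Finset.sum_const, ← Finset.mul_sum, Finset.card_univ, nsmul_eq_mul,
      Nat.card_eq_fintype_card]
    ring
  rw [hsum]
  symm
  refine Finset.sum_bij (fun t _ => (glue e t.1.1 t.2.2.1,
    (glue e t.1.2 t.2.2.2).switch (i (r.edge x)) t.2.1)) ?_ ?_ ?_ ?_
  · rintro ⟨q₁, y, q₂⟩ ht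
    simp only [Finset.mem_product, Finset.mem_univ, true_and] at ht
    obtain ⟨k1, k2, k3, k4, k5⟩ := key q₁ q₂ y ht.1 ht.2
    have h1 := mem_extPairs.1 ht.1
    simp only [cutPairs, Finset.mem_filter, mem_extPairs]
    refine ⟨⟨⟨k1, k2⟩, ⟨fun z => ?_, fun z => ?_⟩, k5⟩, ?_, ?_⟩
    · rw [← hej, glue_vert_inl, h1.2.1.1, hej]
    · rw [← hej, glue_edge_inl, h1.2.1.2, hej]
    · rw [k3]
      exact fun h => y.2 (h ▸ hS _)
    · ext h
      rw [mem_cutComponent, k4, ← hej, componentSetoid_glue_inl]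
      constructor
      · rintro ⟨z, rfl, _⟩
        exact z.2
      · intro hh
        exact ⟨⟨h, hh⟩, rfl, h1.1.2.rel _ _⟩
  -- The data can be read off the joined map: `y` is the other end of the edge at `i x`, and
  -- `toward` recovers the glued map.
  · rintro ⟨q₁, y, q₂⟩ ht ⟨q₁', y', q₂'⟩ ht' h
    simp only [Finset.mem_product, Finset.mem_univ, true_and] at ht ht'
    obtain ⟨-, -, k3, k4, -⟩ := key q₁ q₂ y ht.1 ht.2
    obtain ⟨-, -, k3', k4', -⟩ := key q₁' q₂' y' ht'.1 ht'.2
    simp only [Prod.mk.injEq] at h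
    obtain ⟨h1, h2⟩ := h
    rw [h2, k3'] at k3
    rw [h1, h2, k4'] at k4
    obtain ⟨l1, l2⟩ := glue_injective e h1
    obtain ⟨l3, l4⟩ := glue_injective e k4
    exact Prod.ext (Prod.ext l1 l3.symm) (Prod.ext (Subtype.ext k3.symm) (Prod.ext l2 l4.symm))
  · rintro ⟨c, b⟩ hq
    obtain ⟨-, hy⟩ := cutPairs_subset hr hq
    simp only [cutPairs, Finset.mem_filter, mem_extPairs] at hq
    obtain ⟨⟨⟨hle, hconn⟩, hext, hF⟩, hx, hcut⟩ := hq
    have hx' : b.edge (i x) ≠ c.edge (i x) := by rwa [hext.2]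
    obtain ⟨k1, k2⟩ := toward_spec hle hx'
    have hmem : ∀ h, h ∈ S ↔ (toward c b (i x)).componentSetoid (i x) h := fun h => by
      rw [← hcut, mem_cutComponent]
    obtain ⟨b₁, b₂, hb⟩ := exists_eq_glue e (toward c b (i x))
      (fun z => ⟨⟨_, (hmem _).2 (Setoid.trans' _ ((hmem _).1 z.2) (orbitSetoid_left _ _ _))⟩, rfl⟩)
      (fun z => ⟨⟨_, (hmem _).2 (Setoid.trans' _ ((hmem _).1 z.2) (orbitSetoid_right _ _ _))⟩, rfl⟩)
    rw [hb] at k1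
    obtain ⟨c₁, c₂, hc1, hc2, rfl⟩ := exists_glue_of_le_glue e k1
    -- Restoring one edge of the connected map `b` leaves exactly two components. Both sides are
    -- nonempty, so each is connected.
    have hn : b₁.numComponents + b₂.numComponents = 1 + 1 := by
      rw [← numComponents_glue e, ← hb, k2, hconn]
    have hn1 := b₁.numComponents_pos (j x)
    have hn2 := b₂.numComponents_pos ⟨_, hy⟩
    refine ⟨((c₁, b₁), ⟨_, hy⟩, (c₂, b₂)), ?_, ?_⟩
    · simp only [Finset.mem_product, Finset.mem_univ, true_and, mem_extPairs, mem_connPairs]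
      refine ⟨⟨⟨hc1, show _ = 1 by omega⟩, ⟨fun z => ?_, fun z => ?_⟩, fun z hz => ?_⟩,
        hc2, show _ = 1 by omega⟩
      · have := hext.1 z
        rw [← hej, glue_vert_inl, ← hej] at this
        exact Sum.inl_injective (e.injective this)
      · have := hext.2 z
        rw [← hej, glue_edge_inl, ← hej] at this
        exact Sum.inl_injective (e.injective this)
      · have : (glue e b₁ b₂).edge (i z) = i (r.edge z) := by
          rw [← hb]
          rcases hz with rfl | rfl | hz
          · rw [toward_edge_self, hext.2]
          · refine edge_eq_symm ?_
            rw [r.edge_edge, toward_edge_self, hext.2]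
          · rw [toward_edge_of_eq hx', hext.2]
            rw [hF z hz, hext.2]
        rw [← hej, glue_edge_inl, ← hej] at this
        exact Sum.inl_injective (e.injective this)
    · refine Prod.ext rfl ?_
      dsimp only
      rw [← hb, toward, hext.2, switch_comm, switch_switch]
  · rintro t -
    exact (a.kap_glue e _ _).symm

end Surgery
end TraceMap
end TensorFree

/-! ### Restoring all edges of a fixed component: one moment series per edge -/

namespace TensorFree

open TraceMap

namespace TraceMap

variable {p : ℕ} {H R : Type} [Finite H] {r : TraceMap p R} {i : R → H} {F : Set R} {x : R}

open Classical in
-- Either the edge of `r` at `x` is already an edge of `b`, or restoring it cuts off a component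
-- `S`. This `S` contains all of `r` and is proper, because it misses the former partner of `i x`.
theorem sum_extPairs (f : TraceMap p H × TraceMap p H → ℝ) (hr : r.IsConnected) [Fintype H] :
    ∑ q ∈ extPairs r i F, f q = ∑ q ∈ extPairs r i (insert x (insert (r.edge x) F)), f q +
      ∑ S ∈ Finset.univ.filter (fun S : Finset H => Set.range i ⊆ (S : Set H) ∧ S ≠ Finset.univ),
        ∑ q ∈ cutPairs r i F x S, f q := by
  rw [← Finset.sum_filter_add_sum_filter_not (extPairs r i F)
    (fun q => q.2.edge (i x) = i (r.edge x))]
  congr 1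
  · refine Finset.sum_congr ?_ fun _ _ => rfl
    ext q
    simp only [Finset.mem_filter, mem_extPairs, Set.mem_insert_iff, forall_eq_or_imp]
    constructor
    · rintro ⟨⟨h1, h2, h3⟩, h4⟩
      refine ⟨h1, h2, h4, edge_eq_symm ?_, h3⟩
      rw [r.edge_edge, h4]
    · rintro ⟨h1, h2, h4, _, h3⟩
      exact ⟨⟨h1, h2, h3⟩, h4⟩
  · have hmap : ∀ q ∈ (extPairs r i F).filter (fun q => ¬ q.2.edge (i x) = i (r.edge x)),
        cutComponent (i x) q ∈
          Finset.univ.filter fun S : Finset H => Set.range i ⊆ (S : Set H) ∧ S ≠ Finset.univ := by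
      intro q hq
      rw [Finset.mem_filter] at hq
      obtain ⟨h1, h2⟩ := cutPairs_subset (i := i) (x := x) hr (q := q) (S := cutComponent (i x) q) (F := F)
        (by simpa [cutPairs] using hq)
      simp only [Finset.mem_filter, Finset.mem_univ, true_and]
      exact ⟨Set.range_subset_iff.2 h1, fun h => h2 (h ▸ Finset.mem_univ _)⟩
    rw [← Finset.sum_fiberwise_of_maps_to hmap]
    refine Finset.sum_congr rfl fun S _ => Finset.sum_congr ?_ fun _ _ => rfl
    ext q
    simp [cutPairs, and_assoc]

end TraceMap

namespace Distribution

variable {p : ℕ} (a : Distribution p) {H H' R : Type}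

open Classical in
/-- The sum of the values of a distribution over all connected maps with a given set of
half-edges. -/
noncomputable def connMoment (H : Type) [Finite H] : ℝ :=
  ∑ b : TraceMap p H with b.IsConnected, a.ev b

theorem connMoment_eq_sum [Finite H] : a.connMoment H = ∑ q ∈ connPairs p H, a.kap q.1 := by
  classical
  rw [connMoment, connPairs]
  simp_rw [ev_eq_sum, Finset.sum_filter, Fintype.sum_prod_type]
  rw [Finset.sum_comm]
  refine Finset.sum_congr rfl fun b _ => ?_
  split_ifs with h
  · simp [h]
  · simp [h]

theorem connMoment_congr [Finite H] [Finite H'] (e : H ≃ H') :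
    a.connMoment H = a.connMoment H' := by
  classical
  refine Finset.sum_equiv (relabelEquiv e) (fun b => ?_) fun b _ => ?_
  · simp only [Finset.mem_filter, Finset.mem_univ, true_and, relabelEquiv_apply]
    exact (congrArg (· = 1) (numComponents_relabel e b)).symm.to_iff
  · rw [relabelEquiv_apply, ev_relabel]

/-- The sequence of normalised moments indexed by the number of half-edges. -/
noncomputable def halfEdgeMoment (N : ℕ) : ℝ :=
  if N = 0 then 1 else a.connMoment (Fin N) / (N - 1).factorial

open Classical in
/-- The sum of the free cumulants of all connected maps with a given set of half-edges. -/
noncomputable def connCumulant (H : Type) [Finite H] : ℝ :=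
  ∑ b : TraceMap p H with b.IsConnected, a.kap b

theorem connCumulant_congr [Finite H] [Finite H'] (e : H ≃ H') :
    a.connCumulant H = a.connCumulant H' := by
  classical
  refine Finset.sum_equiv (relabelEquiv e) (fun b => ?_) fun b _ => ?_
  · simp only [Finset.mem_filter, Finset.mem_univ, true_and, relabelEquiv_apply]
    exact (congrArg (· = 1) (numComponents_relabel e b)).symm.to_iff
  · rw [relabelEquiv_apply, kap_relabel]

/-- The sequence of normalised free cumulants indexed by the number of half-edges. -/
noncomputable def halfEdgeCumulant (N : ℕ) : ℝ :=
  if N = 0 then 1 else a.connCumulant (Fin N) / (N - 1).factorial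

theorem connMoment_eq [Finite H] (h : Nat.card H ≠ 0) :
    a.connMoment H = (Nat.card H - 1).factorial * a.halfEdgeMoment (Nat.card H) := by
  rw [halfEdgeMoment, if_neg h, a.connMoment_congr (Finite.equivFin H)]
  field_simp

theorem connCumulant_eq [Finite H] (h : Nat.card H ≠ 0) :
    a.connCumulant H = (Nat.card H - 1).factorial * a.halfEdgeCumulant (Nat.card H) := by
  rw [halfEdgeCumulant, if_neg h, a.connCumulant_congr (Finite.equivFin H)]
  field_simp

theorem card_mul_connMoment [Finite H] (h : Nat.card H ≠ 0) :
    Nat.card H * a.connMoment H = (Nat.card H).factorial * a.halfEdgeMoment (Nat.card H) := by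
  rw [a.connMoment_eq h, ← mul_assoc, ← Nat.cast_mul, Nat.mul_factorial_pred h]

open Classical in
theorem sum_supersets {α : Type*} [Fintype α] (I : Finset α) (g : ℕ → ℝ) :
    ∑ S : Finset α with I ⊆ S, g (S.card - I.card)
      = ∑ j ∈ Finset.range (Fintype.card α - I.card + 1),
        ((Fintype.card α - I.card).choose j : ℝ) * g j := by
  have h := Finset.sum_powerset_apply_card g (x := Iᶜ)
  rw [Finset.card_compl] at h
  simp_rw [nsmul_eq_mul] at h
  rw [← h]
  refine Finset.sum_bij' (fun S _ => S \ I) (fun U _ => U ∪ I) ?_ ?_ ?_ ?_ ?_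
  · intro S _
    rw [Finset.mem_powerset]
    intro z hz
    simp only [Finset.mem_sdiff] at hz
    simpa using hz.2
  · intro U _
    simp
  · intro S hS
    simp only [Finset.mem_filter, Finset.mem_univ, true_and] at hS
    exact Finset.sdiff_union_of_subset hS
  · intro U hU
    rw [Finset.mem_powerset] at hU
    rw [Finset.union_sdiff_right, Finset.sdiff_eq_self_iff_disjoint]
    exact Finset.disjoint_left.2 fun z hz hz' => by simpa [hz'] using hU hz
  · intro S hS
    simp only [Finset.mem_filter, Finset.mem_univ, true_and] at hS
    rw [Finset.card_sdiff_of_subset hS]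

/-- If all edges of `r` are edges of the connected map `b`, the image of `i` is closed in `b` and
hence everything. Then `c = b` is a copy of `r`. -/
theorem sum_extPairs_full [Finite H] [Finite R] {r : TraceMap p R} (hr : r.IsConnected) {i : R → H}
    (hi : Function.Injective i) {F : Set R} (hF : ∀ z, z ∈ F) :
    ∑ q ∈ extPairs r i F, a.kap q.1
      = if Nat.card H - Nat.card R = 0 then a.kap r else 0 := by
  classical
  have hsurj : ∀ q ∈ extPairs r i F, Function.Surjective i ∧ q.1 = q.2 := by
    rintro ⟨c, b⟩ hq
    rw [mem_extPairs] at hq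
    obtain ⟨⟨hle, hb⟩, hext, hF'⟩ := hq
    have hv := vert_eq_of_le hle
    have hextb : Extends r i b := ⟨fun z => by rw [← hv]; exact hext.1 z, fun z => hF' z (hF z)⟩
    obtain ⟨x⟩ := hr.nonempty
    have hs : Function.Surjective i := by
      intro y
      exact (hextb.mem_range_iff (hb.rel (i x) y)).1 ⟨x, rfl⟩
    refine ⟨hs, eq_of_edge_eq hv fun z => ?_⟩
    obtain ⟨w, rfl⟩ := hs z
    rw [hextb.2, hext.2]
  have hcard : Nat.card R ≤ Nat.card H := Nat.card_le_card_of_injective i hi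
  split_ifs with h
  · have hbij : Function.Bijective i := by
      have := Fintype.ofFinite H
      have := Fintype.ofFinite R
      rw [Fintype.bijective_iff_injective_and_card, ← Nat.card_eq_fintype_card,
        ← Nat.card_eq_fintype_card]
      exact ⟨hi, by omega⟩
    set e := Equiv.ofBijective i hbij with he
    have hei : ∀ z, e z = i z := fun z => rfl
    have hext : Extends r i (r.relabel e) := by
      constructor <;> intro z <;> simp [relabel, ← hei]
    have huniq : ∀ c, Extends r i c → c = r.relabel e := by
      intro c hc
      apply TraceMap.ext <;> ext z <;> obtain ⟨w, rfl⟩ := hbij.2 z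
      · rw [hc.1, hext.1]
      · rw [hc.2, hext.2]
    have : extPairs r i F = {(r.relabel e, r.relabel e)} := by
      ext ⟨c, b⟩
      rw [Finset.mem_singleton]
      constructor
      · intro hq
        have h1 := (hsurj _ hq).2
        rw [mem_extPairs] at hq
        have h2 := huniq _ hq.2.1
        dsimp only at h1 h2
        rw [← h1, h2]
      · intro hq
        rw [Prod.mk.injEq] at hq
        obtain ⟨rfl, rfl⟩ := hq
        rw [mem_extPairs]
        refine ⟨⟨le_rfl, ?_⟩, hext, fun z _ => hext.2 z⟩
        exact (numComponents_relabel e r).trans hr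
    rw [this, Finset.sum_singleton, kap_relabel]
  · refine Finset.sum_eq_zero fun q hq => ?_
    exact absurd (Nat.card_congr (Equiv.ofBijective i ⟨hi, (hsurj q hq).1⟩)) (by omega)

/-- The generating function of the normalised moments. -/
noncomputable def halfEdgeSeries : PowerSeries ℝ := PowerSeries.mk a.halfEdgeMoment

/-- Induction on the number `f` of edges of `r` not yet known to be in `b`. Treating one more edge
distributes the half-edges outside `r` between the part kept and the part cut off; the factorials
turn this choice of subset into a product of series. -/
theorem sum_extPairs_eq (hp : 2 ≤ p) (hpe : Even p) (f : ℕ) {H : Type} [Finite H] [Finite R]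
    {r : TraceMap p R} (hr : r.IsConnected) {i : R → H} (hi : Function.Injective i) {F : Set R}
    (hF : ∀ z ∈ F, r.edge z ∈ F) (hf : Nat.card {z // z ∉ F} = 2 * f) :
    ∑ q ∈ extPairs r i F, a.kap q.1 = a.kap r * ((Nat.card H - Nat.card R).factorial *
      PowerSeries.coeff (Nat.card H - Nat.card R) (a.halfEdgeSeries ^ f)) := by
  classical
  induction f generalizing H F with
  | zero =>
    have hF' : ∀ z, z ∈ F := by
      intro z
      by_contra hz
      have := Finite.card_eq_zero_iff.1 hf
      exact this.false ⟨z, hz⟩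
    rw [a.sum_extPairs_full hr hi hF', pow_zero, PowerSeries.coeff_one]
    split_ifs with h
    · simp [h]
    · simp
  | succ f ih =>
    have := Fintype.ofFinite H
    have := Fintype.ofFinite R
    obtain ⟨x, hx⟩ : ∃ x, x ∉ F := by
      by_contra! h
      have : IsEmpty {z // z ∉ F} := ⟨fun z => z.2 (h z.1)⟩
      rw [Nat.card_of_isEmpty] at hf
      omega
    have hx' : r.edge x ∉ F := fun h => hx (by simpa [r.edge_edge] using hF _ h)
    set F' := insert x (insert (r.edge x) F) with hF'
    have hclosed : ∀ z ∈ F', r.edge z ∈ F' := by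
      rintro z (rfl | rfl | hz)
      · simp [hF']
      · simp [hF', r.edge_edge]
      · simp [hF', hF z hz]
    have hcard : Nat.card {z // z ∉ F'} = 2 * f := by
      have h1 : Nat.card {z // z ∉ F'} = (Fᶜ \ {x, r.edge x}).ncard := by
        rw [← Nat.card_coe_set_eq]
        refine Nat.card_congr (Equiv.subtypeEquivRight fun z => ?_)
        simp [hF']; tauto
      have h2 : Nat.card {z // z ∉ F} = Fᶜ.ncard := by
        rw [← Nat.card_coe_set_eq]; rfl
      rw [h1, Set.ncard_sdiff, ← h2, hf, Set.ncard_pair (r.edge_ne x).symm]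
      · omega
      · rintro z (rfl | rfl)
        · exact hx
        · exact hx'
    set I : Finset H := Finset.univ.image i with hI
    have hIc : I.card = Nat.card R := by
      rw [Finset.card_image_of_injective _ hi, Finset.card_univ, Nat.card_eq_fintype_card]
    have hIS : ∀ S : Finset H, I ⊆ S ↔ Set.range i ⊆ (S : Set H) := by
      intro S
      simp [hI, Finset.image_subset_iff, Set.range_subset_iff]
    set n := Nat.card H - Nat.card R with hn
    -- The contribution of a set `S` with `j` half-edges outside the image of `i`. The marked
    -- half-edge turns the normalisation (N-1)! of the moment of the complement into N!.
    let g : ℕ → ℝ := fun j => a.kap r * (j.factorial * PowerSeries.coeff j (a.halfEdgeSeries ^ f)) *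
      ((n - j).factorial * a.halfEdgeMoment (n - j))
    have hg : ∀ S : Finset H, (∀ z, i z ∈ S) → S ≠ Finset.univ →
        ∑ q ∈ cutPairs r i F x S, a.kap q.1 = g (S.card - I.card) := by
      intro S hS hSu
      have h1 : Nat.card {h // h ∈ S} = S.card := by simp
      have h2 : Nat.card {h // ¬ h ∈ S} = Nat.card H - S.card := by
        simp [Nat.card_eq_fintype_card, Fintype.card_subtype_compl]
      have h4 : S.card < Nat.card H := by
        rw [Nat.card_eq_fintype_card]; exact (Finset.card_lt_iff_ne_univ S).2 hSu
      have h3 : I.card ≤ S.card := Finset.card_le_card ((hIS S).2 (Set.range_subset_iff.2 hS))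
      rw [sum_cutPairs hp hpe a hr hi hx hx' hS, ← connMoment_eq_sum, a.card_mul_connMoment (by omega),
        ih (fun z w h => hi (congrArg Subtype.val h)) hclosed hcard, h1, h2, ← hIc]
      simp only [g]
      rw [show Nat.card H - S.card = n - (S.card - I.card) by omega]
    -- The pairs for which the edge is already in `b` supply the missing term `S = univ`: there the
    -- second factor of `g` is 0! times `halfEdgeMoment 0 = 1`.
    have hins : (Finset.univ.filter fun S : Finset H => I ⊆ S) = insert Finset.univ
        (Finset.univ.filter fun S : Finset H => Set.range i ⊆ (S : Set H) ∧ S ≠ Finset.univ) := by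
      ext S
      simp only [Finset.mem_filter, Finset.mem_univ, true_and, Finset.mem_insert, hIS]
      constructor
      · intro h
        by_cases hS : S = Finset.univ
        · exact Or.inl hS
        · exact Or.inr ⟨h, hS⟩
      · rintro (rfl | h)
        · simp
        · exact h.1
    have hsup := sum_supersets I g
    have hIn : Fintype.card H - I.card = n := by rw [hIc, ← Nat.card_eq_fintype_card]
    rw [hins, Finset.sum_insert (by simp), Finset.card_univ, hIn] at hsup
    have hn0 : g n = a.kap r * (n.factorial * PowerSeries.coeff n (a.halfEdgeSeries ^ f)) := by
      simp [g, halfEdgeMoment]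
    rw [sum_extPairs (x := x) _ hr, ih hi hclosed hcard, ← hn0, Finset.sum_congr rfl
      (fun S hS => hg S (Set.range_subset_iff.1 (Finset.mem_filter.1 hS).2.1) (Finset.mem_filter.1 hS).2.2), hsup, pow_succ,
      PowerSeries.coeff_mul, Finset.Nat.sum_antidiagonal_eq_sum_range_succ_mk, Finset.mul_sum,
      Finset.mul_sum]
    refine Finset.sum_congr rfl fun j hj => ?_
    have hjn : j ≤ n := by simpa [Nat.lt_succ_iff] using hj
    have hc : ((n.choose j * j.factorial * (n - j).factorial : ℕ) : ℝ) = (n.factorial : ℝ) := by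
      rw [Nat.choose_mul_factorial_mul_factorial hjn]
    push_cast at hc
    simp only [g, halfEdgeSeries, PowerSeries.coeff_mk]
    rw [← hc]
    ring

end Distribution
end TensorFree

/-! ### Decomposition at the root, and the recursion by half-edges -/

namespace TensorFree

open TraceMap

namespace TraceMap

variable {p : ℕ} {H : Type}

theorem even_card [Finite H] (b : TraceMap p H) : Even (Nat.card H) := by
  have := Fintype.ofFinite H
  rw [Nat.card_eq_fintype_card]
  exact even_card_of_involution Finset.univ b.edge (by simp) (fun z _ => b.edge_edge z)
    fun z _ => b.edge_ne z

/-- The half-edges split into cycles of `vert`, all of length `p`. -/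
theorem dvd_card [Finite H] (b : TraceMap p H) : p ∣ Nat.card H := by
  classical
  have := Fintype.ofFinite H
  have h : ∀ ω : MulAction.orbitRel.Quotient (Subgroup.zpowers b.vert) H,
      Nat.card (MulAction.orbitRel.Quotient.orbit ω) = p := by
    intro ω
    induction ω using Quotient.inductionOn with
    | h x =>
    have h1 := MulAction.minimalPeriod_eq_card (a := b.vert) (b := x)
    have h2 := b.regular x
    rw [← Nat.card_eq_fintype_card] at h1
    exact h1.symm.trans h2
  rw [Nat.card_congr (MulAction.selfEquivSigmaOrbits' (Subgroup.zpowers b.vert) H), Nat.card_sigma,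
    Finset.sum_congr rfl (fun ω _ => h ω), Finset.sum_const, smul_eq_mul]
  exact dvd_mul_left p _

open Classical in
/-- The component of `x`. -/
noncomputable def component [Fintype H] (c : TraceMap p H) (x : H) : Finset H :=
  Finset.univ.filter fun h => c.componentSetoid x h

theorem mem_component [Fintype H] {c : TraceMap p H} {x h : H} :
    h ∈ c.component x ↔ c.componentSetoid x h := by
  simp [component]

theorem component_eq_of_extends [Fintype H] {c : TraceMap p H} {x : H} {S : Finset H} (hx : x ∈ S)
    {r : TraceMap p {h // h ∈ S}} (hr : r.IsConnected) (h : Extends r Subtype.val c) :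
    c.component x = S := by
  ext y
  rw [mem_component]
  constructor
  · intro hxy
    have := (h.mem_range_iff hxy).1 ⟨⟨x, hx⟩, rfl⟩
    simpa using this
  · intro hy
    exact h.rel (hr.rel ⟨x, hx⟩ ⟨y, hy⟩)

theorem existsUnique_extends [Fintype H] (c : TraceMap p H) (x : H) :
    ∃! r : TraceMap p {h // h ∈ c.component x}, r.IsConnected ∧ Extends r Subtype.val c := by
  classical
  set S := c.component x with hS
  obtain ⟨r, c₂, h⟩ := exists_eq_glue (Equiv.sumCompl (· ∈ S)) c
    (fun z => ⟨⟨_, mem_component.2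
      (Setoid.trans' _ (mem_component.1 z.2) (orbitSetoid_left _ _ _))⟩, rfl⟩)
    (fun z => ⟨⟨_, mem_component.2
      (Setoid.trans' _ (mem_component.1 z.2) (orbitSetoid_right _ _ _))⟩, rfl⟩)
  have hext : Extends r (Subtype.val : {h // h ∈ S} → H) c := by
    constructor <;> intro z <;> rw [h]
    · exact glue_vert_inl _ _ _ z
    · exact glue_edge_inl _ _ _ z
  have hxS : x ∈ S := mem_component.2 (Setoid.refl' _ _)
  refine ⟨r, ⟨isConnected_of_rel ⟨x, hxS⟩ fun y => ?_, hext⟩, ?_⟩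
  · have hy := mem_component.1 y.2
    rw [h] at hy
    obtain ⟨z, hz, hz'⟩ := (componentSetoid_glue_inl (Equiv.sumCompl (· ∈ S)) ⟨x, hxS⟩ _).1 hy
    have hyz : y = z := Subtype.ext hz
    rwa [hyz]
  · rintro r' ⟨_, hext'⟩
    apply TraceMap.ext <;> ext z
    · rw [← hext.1, ← hext'.1]
    · rw [← hext.2, ← hext'.2]

open Classical in
-- Pairs are sorted by the component `S` of `x` in the smaller map and by its unique restriction `r`
-- to `S`. No edge of `r` is required to lie in the larger map, hence `F = ∅`.
theorem sum_connPairs [Fintype H] (f : TraceMap p H × TraceMap p H → ℝ) (x : H) :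
    ∑ q ∈ connPairs p H, f q = ∑ S : Finset H with {x} ⊆ S,
      ∑ r : TraceMap p {h // h ∈ S} with r.IsConnected, ∑ q ∈ extPairs r Subtype.val ∅, f q := by
  have hmap : ∀ q ∈ connPairs p H, q.1.component x ∈ Finset.univ.filter
      fun S : Finset H => {x} ⊆ S := by
    intro q _
    simp [mem_component]
  rw [← Finset.sum_fiberwise_of_maps_to hmap]
  refine Finset.sum_congr rfl fun S hS => ?_
  have hxS : x ∈ S := by simpa using hS
  have hr : ∀ r : TraceMap p {h // h ∈ S},
      (if r.IsConnected then ∑ q ∈ extPairs r Subtype.val ∅, f q else 0)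
      = ∑ q ∈ connPairs p H, if r.IsConnected ∧ Extends r Subtype.val q.1 then f q else 0 := by
    intro r
    rw [extPairs, Finset.sum_filter]
    split_ifs with h <;> simp [h]
  rw [Finset.sum_filter, Finset.sum_filter, Finset.sum_congr rfl fun r _ => hr r, Finset.sum_comm]
  refine Finset.sum_congr rfl fun q _ => ?_
  split_ifs with h
  · subst h
    obtain ⟨r, ⟨hr1, hr2⟩, hr3⟩ := existsUnique_extends q.1 x
    rw [Finset.sum_eq_single r]
    · simp [hr1, hr2]
    · intro r' _ hne
      by_contra hc
      simp at hc
      exact hne (hr3 r' ⟨hc.1, hc.2.1⟩)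
    · simp
  · symm
    refine Finset.sum_eq_zero fun r _ => ?_
    by_contra hc
    simp at hc
    exact h (component_eq_of_extends hxS hc.1 hc.2.1)

end TraceMap

namespace Distribution

variable {p : ℕ} (a : Distribution p) {H : Type}

theorem halfEdgeMoment_succ (hp : 2 ≤ p) (hpe : Even p) (n : ℕ) :
    a.halfEdgeMoment (n + 1) = ∑ j ∈ Finset.range (n + 1), a.halfEdgeCumulant (j + 1) *
      PowerSeries.coeff (n - j) (a.halfEdgeSeries ^ ((j + 1) / 2)) := by
  classical
  -- Here `j + 1` is the size of the root component: the root, here `0`, is fixed, so only `j` of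
  -- the other `n` half-edges are chosen. The exponent `(j + 1) / 2` is its number of edges.
  let g : ℕ → ℝ := fun j => (j.factorial * a.halfEdgeCumulant (j + 1)) *
    ((n - j).factorial * PowerSeries.coeff (n - j) (a.halfEdgeSeries ^ ((j + 1) / 2)))
  have h1 : a.connMoment (Fin (n + 1)) = ∑ j ∈ Finset.range (n + 1), (n.choose j : ℝ) * g j := by
    rw [connMoment_eq_sum, sum_connPairs _ 0]
    have h2 := sum_supersets ({0} : Finset (Fin (n + 1))) g
    rw [Fintype.card_fin, Finset.card_singleton, Nat.add_sub_cancel] at h2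
    rw [← h2]
    refine Finset.sum_congr rfl fun S hS => ?_
    have hS0 : 0 < S.card := Finset.card_pos.2 ⟨0, by simpa using hS⟩
    have hSn : S.card ≤ n + 1 := by simpa using Finset.card_le_univ S
    have hc : Nat.card {h // h ∈ S} = S.card := by simp
    have h3 : ∀ r ∈ (Finset.univ.filter fun r : TraceMap p {h // h ∈ S} => r.IsConnected),
        ∑ q ∈ extPairs r Subtype.val ∅, a.kap q.1 = a.kap r * ((n + 1 - S.card).factorial *
          PowerSeries.coeff (n + 1 - S.card) (a.halfEdgeSeries ^ (S.card / 2))) := by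
      intro r hr
      obtain ⟨k, hk⟩ := r.even_card
      rw [hc] at hk
      rw [a.sum_extPairs_eq hp hpe (S.card / 2) (Finset.mem_filter.1 hr).2 Subtype.val_injective
        (by simp), hc, Nat.card_fin]
      rw [Nat.card_congr (Equiv.subtypeUnivEquiv (by simp)), hc]
      omega
    rw [Finset.sum_congr rfl h3, ← Finset.sum_mul]
    change a.connCumulant {h // h ∈ S} * _ = _
    rw [a.connCumulant_eq (by omega), hc]
    simp only [g]
    rw [Nat.sub_add_cancel hS0, show n + 1 - S.card = n - (S.card - 1) by omega]
  rw [halfEdgeMoment, if_neg (by omega), h1, Nat.add_sub_cancel, Finset.sum_div]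
  refine Finset.sum_congr rfl fun j hj => ?_
  have hjn : j ≤ n := by simpa [Nat.lt_succ_iff] using hj
  have hc : ((n.choose j * j.factorial * (n - j).factorial : ℕ) : ℝ) = (n.factorial : ℝ) := by
    rw [Nat.choose_mul_factorial_mul_factorial hjn]
  push_cast at hc
  rw [div_eq_iff (by positivity), ← hc]
  simp only [g]
  ring

end Distribution

/-! ### From labelled maps to rooted unlabelled maps -/

/-- Transport of a rooted map along a relabelling of its half-edges. -/
def LabelledRootedMap.relabel {p n : ℕ} (b : LabelledRootedMap p n) (e : Equiv.Perm (Fin (p * n))) :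
    LabelledRootedMap p n where
  map := b.map.relabel e
  connected := (numComponents_relabel e b.map).trans b.connected
  root := e b.root

/-- A rooted map has no nontrivial automorphism. -/
theorem LabelledRootedMap.relabel_injective {p n : ℕ} (b : LabelledRootedMap p n) :
    Function.Injective b.relabel := by
  intro e e' h
  have h1 : b.map.relabel e = b.map.relabel e' := congrArg LabelledRootedMap.map h
  have h2 : e b.root = e' b.root := congrArg LabelledRootedMap.root h
  have hv : ∀ z, (b.map.relabel e).vert (e z) = e (b.map.vert z) := by simp [TraceMap.relabel]
  have hv' : ∀ z, (b.map.relabel e).vert (e' z) = e' (b.map.vert z) := by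
    rw [h1]; simp [TraceMap.relabel]
  have he : ∀ z, (b.map.relabel e).edge (e z) = e (b.map.edge z) := by simp [TraceMap.relabel]
  have he' : ∀ z, (b.map.relabel e).edge (e' z) = e' (b.map.edge z) := by
    rw [h1]; simp [TraceMap.relabel]
  ext z : 1
  refine (iff_of_orbitSetoid (P := fun z => e z = e' z) ?_ ?_ (b.connected.rel b.root z)).1 h2
  · intro z
    rw [← hv, ← hv', EmbeddingLike.apply_eq_iff_eq]
  · intro z
    rw [← he, ← he', EmbeddingLike.apply_eq_iff_eq]

/-- The isomorphism class of a labelled rooted map. -/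
def RootedMap.mk {p n : ℕ} (b : LabelledRootedMap p n) : RootedMap p n := Quotient.mk _ b

open Classical in
-- Labelled rooted maps are counted in two ways: by the choice of a root on each connected map, and
-- by isomorphism classes, each of which is a free orbit of the permutations of the half-edges.
theorem factorial_mul_sum_rootedMap {p n : ℕ} (g : TraceMap p (Fin (p * n)) → ℝ)
    (hg : ∀ b c : LabelledRootedMap p n, b ≈ c → g b.map = g c.map) :
    ((p * n).factorial : ℝ) * ∑ b : RootedMap p n,
        Quotient.lift (fun b : LabelledRootedMap p n => g b.map) hg b
      = (p * n : ℕ) * ∑ b : TraceMap p (Fin (p * n)) with b.IsConnected, g b := by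
  have : Fintype (LabelledRootedMap p n) := Fintype.ofFinite _
  have h1 : ∑ b : LabelledRootedMap p n, g b.map
      = (p * n : ℕ) * ∑ b : TraceMap p (Fin (p * n)) with b.IsConnected, g b := by
    have : ∑ b : LabelledRootedMap p n, g b.map
        = ∑ t ∈ (Finset.univ.filter fun b : TraceMap p (Fin (p * n)) => b.IsConnected) ×ˢ
            (Finset.univ : Finset (Fin (p * n))), g t.1 := by
      refine Finset.sum_bij (fun b _ => (b.map, b.root)) ?_ ?_ ?_ (fun _ _ => rfl)
      · intro b _
        simpa using b.connected
      · rintro ⟨b, hb, r⟩ _ ⟨c, hc, s⟩ _ h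
        simp only [Prod.mk.injEq] at h
        obtain ⟨rfl, rfl⟩ := h
        rfl
      · rintro ⟨b, r⟩ h
        simp only [Finset.mem_product, Finset.mem_filter, Finset.mem_univ, true_and, and_true] at h
        exact ⟨⟨b, h, r⟩, Finset.mem_univ _, rfl⟩
    rw [this, Finset.sum_product]
    simp [Finset.mul_sum]
  rw [← h1, ← Finset.sum_fiberwise Finset.univ RootedMap.mk]
  refine (Finset.mul_sum _ _ _).trans ?_
  refine Finset.sum_congr rfl fun q _ => ?_
  obtain ⟨b, rfl⟩ : ∃ b, RootedMap.mk b = q := Quotient.exists_rep q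
  have h2 : ∑ c : LabelledRootedMap p n with RootedMap.mk c = RootedMap.mk b, g c.map
      = ∑ _e : Equiv.Perm (Fin (p * n)), g b.map := by
    symm
    refine Finset.sum_bij (fun e _ => b.relabel e) ?_ ?_ ?_ ?_
    · intro e _
      simp only [Finset.mem_filter, Finset.mem_univ, true_and]
      exact (Quotient.sound (s := LabelledRootedMap.setoid p n) ⟨e, rfl, rfl⟩).symm
    · intro e _ e' _ h
      exact b.relabel_injective h
    · intro c hc
      simp only [Finset.mem_filter, Finset.mem_univ, true_and] at hc
      obtain ⟨e, h3, h4⟩ := Quotient.exact (s := LabelledRootedMap.setoid p n) hc.symm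
      refine ⟨e, Finset.mem_univ _, ?_⟩
      cases c
      simp only [LabelledRootedMap.relabel] at *
      subst h3 h4
      rfl
    · intro e _
      exact hg _ _ ⟨e, rfl, rfl⟩
  rw [h2, Finset.sum_const, Finset.card_univ, Fintype.card_perm, Fintype.card_fin, nsmul_eq_mul]
  rfl

namespace Distribution

variable {p : ℕ} (a : Distribution p)

theorem halfEdgeMoment_mul (hp : 2 ≤ p) (n : ℕ) : a.halfEdgeMoment (p * n) = a.moment n := by
  classical
  rcases eq_or_ne n 0 with rfl | hn
  · simp [halfEdgeMoment, moment]
  have hpn : p * n ≠ 0 := Nat.mul_ne_zero (by omega) hn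
  rw [moment, if_neg hn, halfEdgeMoment, if_neg hpn, div_eq_iff (by positivity)]
  have h := factorial_mul_sum_rootedMap (p := p) (n := n) (fun b => a.val b) (by
      rintro b c ⟨e, h, _⟩
      rw [← h, a.val_relabel])
  rw [← Nat.mul_factorial_pred hpn, Nat.cast_mul, mul_assoc] at h
  have h' := mul_left_cancel₀ (Nat.cast_ne_zero.2 hpn) h
  refine Eq.trans ?_ (h'.symm.trans (mul_comm _ _))
  rw [connMoment]
  simp_rw [ev_fin]

theorem halfEdgeCumulant_mul (hp : 2 ≤ p) (n : ℕ) :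
    a.halfEdgeCumulant (p * n) = a.freeCumulant n := by
  classical
  rcases eq_or_ne n 0 with rfl | hn
  · simp [halfEdgeCumulant, freeCumulant]
  have hpn : p * n ≠ 0 := Nat.mul_ne_zero (by omega) hn
  rw [freeCumulant, if_neg hn, halfEdgeCumulant, if_neg hpn, div_eq_iff (by positivity)]
  have h := factorial_mul_sum_rootedMap (p := p) (n := n) (fun b => a.mapCumulant b) (by
      rintro b c ⟨e, h, _⟩
      rw [← h, a.mapCumulant_relabel])
  rw [← Nat.mul_factorial_pred hpn, Nat.cast_mul, mul_assoc] at h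
  have h' := mul_left_cancel₀ (Nat.cast_ne_zero.2 hpn) h
  refine Eq.trans ?_ (h'.symm.trans (mul_comm _ _))
  rw [connCumulant]
  simp_rw [kap_fin]

theorem halfEdgeMoment_of_not_dvd {N : ℕ} (h : ¬ p ∣ N) : a.halfEdgeMoment N = 0 := by
  rw [halfEdgeMoment, if_neg (by rintro rfl; exact h (dvd_zero p)), connMoment, Finset.sum_eq_zero,
    zero_div]
  intro b _
  exact absurd (by simpa using b.dvd_card) h

theorem halfEdgeCumulant_of_not_dvd {N : ℕ} (h : ¬ p ∣ N) : a.halfEdgeCumulant N = 0 := by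
  rw [halfEdgeCumulant, if_neg (by rintro rfl; exact h (dvd_zero p)), connCumulant, Finset.sum_eq_zero,
    zero_div]
  intro b _
  exact absurd (by simpa using b.dvd_card) h

end Distribution
end TensorFree

namespace TensorFree

/-! ### Exponential bounds for solutions of a functional equation and for inverses -/

section Bounds

/-- The truncated weighted `ℓ¹`-norm of a power series. -/
noncomputable def truncNorm (t : ℝ) (n : ℕ) (f : PowerSeries ℝ) : ℝ :=
  ∑ j ∈ Finset.range n, |PowerSeries.coeff j f| * t ^ j

variable {t : ℝ}

theorem truncNorm_nonneg (ht : 0 ≤ t) (n : ℕ) (f : PowerSeries ℝ) : 0 ≤ truncNorm t n f :=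
  Finset.sum_nonneg fun _ _ => by positivity

theorem truncNorm_mono (ht : 0 ≤ t) {m n : ℕ} (h : m ≤ n) (f : PowerSeries ℝ) :
    truncNorm t m f ≤ truncNorm t n f :=
  Finset.sum_le_sum_of_subset_of_nonneg (by simpa using h) fun _ _ _ => by positivity

theorem truncNorm_mul_le (ht : 0 ≤ t) (n : ℕ) (f g : PowerSeries ℝ) :
    truncNorm t n (f * g) ≤ truncNorm t n f * truncNorm t n g := by
  have h1 : truncNorm t n (f * g) ≤ ∑ m ∈ Finset.range n, ∑ k ∈ Finset.range (m + 1),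
      (|PowerSeries.coeff k f| * t ^ k) * (|PowerSeries.coeff (m - k) g| * t ^ (m - k)) := by
    refine Finset.sum_le_sum fun m _ => ?_
    rw [PowerSeries.coeff_mul, Finset.Nat.sum_antidiagonal_eq_sum_range_succ_mk]
    refine (mul_le_mul_of_nonneg_right (Finset.abs_sum_le_sum_abs _ _) (by positivity)).trans ?_
    rw [Finset.sum_mul]
    refine Finset.sum_le_sum fun k hk => ?_
    have hkm : k ≤ m := by simpa [Nat.lt_succ_iff] using hk
    rw [abs_mul, ← pow_mul_pow_sub t hkm]
    exact le_of_eq (by ring)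
  refine h1.trans ?_
  rw [Finset.sum_range_diag_flip n fun k j => (|PowerSeries.coeff k f| * t ^ k) *
    (|PowerSeries.coeff j g| * t ^ j), truncNorm, Finset.sum_mul]
  refine Finset.sum_le_sum fun k _ => ?_
  rw [← Finset.mul_sum]
  exact mul_le_mul_of_nonneg_left (truncNorm_mono ht (Nat.sub_le n k) g) (by positivity)

theorem truncNorm_pow_le (ht : 0 ≤ t) (n : ℕ) (f : PowerSeries ℝ) (k : ℕ) :
    truncNorm t n (f ^ k) ≤ truncNorm t n f ^ k := by
  induction k with
  | zero =>
    rw [pow_zero, pow_zero, truncNorm]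
    simp_rw [PowerSeries.coeff_one]
    rcases n with _ | n
    · simp
    · rw [Finset.sum_range_succ']
      simp
  | succ k ih =>
    rw [pow_succ, pow_succ]
    exact (truncNorm_mul_le ht n _ _).trans
      (mul_le_mul_of_nonneg_right ih (truncNorm_nonneg ht n f))

/-- If `U(x) = V(x U(x) ^ q)` and the coefficients of `V` are exponentially bounded, then so are the
coefficients of `U`. -/
theorem exponentiallyBounded_of_recursion {u v : ℕ → ℝ} (q : ℕ)
    (h : ∀ n, u n = ∑ k ∈ Finset.range (n + 1),
      v k * PowerSeries.coeff (n - k) (PowerSeries.mk u ^ (q * k)))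
    (hv : ExponentiallyBounded v) : ExponentiallyBounded u := by
  obtain ⟨K, hK, hv⟩ := hv
  -- Chosen so that a bound `2` on the norm of `U` makes the k-th term at most (1/2)^k; these sum to
  -- at most `2`, so the bound reproduces itself.
  set t : ℝ := 1 / (2 * K * 2 ^ q) with ht
  have ht0 : 0 < t := by positivity
  have hKt : K * t * 2 ^ q = 1 / 2 := by rw [ht]; field_simp
  set U := PowerSeries.mk u with hU
  have key : ∀ n, truncNorm t n U ≤ 2 := by
    intro n
    induction n with
    | zero => simp [truncNorm]
    | succ n ih =>
      have h1 : truncNorm t (n + 1) U ≤ ∑ m ∈ Finset.range (n + 1), ∑ k ∈ Finset.range (m + 1),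
          (K * t) ^ k * (|PowerSeries.coeff (m - k) (U ^ (q * k))| * t ^ (m - k)) := by
        refine Finset.sum_le_sum fun m _ => ?_
        rw [hU, PowerSeries.coeff_mk, h m, ← hU]
        refine (mul_le_mul_of_nonneg_right (Finset.abs_sum_le_sum_abs _ _) (by positivity)).trans ?_
        rw [Finset.sum_mul]
        refine Finset.sum_le_sum fun k hk => ?_
        have hkm : k ≤ m := by simpa [Nat.lt_succ_iff] using hk
        rw [abs_mul, mul_pow, ← pow_mul_pow_sub t hkm]
        calc _ = |v k| * (t ^ k * (|PowerSeries.coeff (m - k) (U ^ (q * k))| * t ^ (m - k))) := by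
              ring
          _ ≤ K ^ k * (t ^ k * (|PowerSeries.coeff (m - k) (U ^ (q * k))| * t ^ (m - k))) :=
              mul_le_mul_of_nonneg_right (hv k) (by positivity)
          _ = _ := by ring
      rw [Finset.sum_range_diag_flip (n + 1) fun k j =>
        (K * t) ^ k * (|PowerSeries.coeff j (U ^ (q * k))| * t ^ j)] at h1
      refine h1.trans ?_
      have h2 : ∀ k ∈ Finset.range (n + 1), ∑ j ∈ Finset.range (n + 1 - k),
          (K * t) ^ k * (|PowerSeries.coeff j (U ^ (q * k))| * t ^ j) ≤ (1 / 2 : ℝ) ^ k := by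
        intro k _
        rw [← Finset.mul_sum]
        -- For `k ≥ 1` the factor x^k shortens the truncation to at most `n`, so the induction
        -- hypothesis applies; for `k = 0` the power is trivial.
        have h3 : truncNorm t (n + 1 - k) (U ^ (q * k)) ≤ 2 ^ (q * k) := by
          refine (truncNorm_pow_le ht0.le _ _ _).trans ?_
          rcases Nat.eq_zero_or_pos k with rfl | hk
          · simp
          · exact pow_le_pow_left₀ (truncNorm_nonneg ht0.le _ _)
              ((truncNorm_mono ht0.le (by omega) U).trans ih) _
        refine (mul_le_mul_of_nonneg_left h3 (by positivity)).trans (le_of_eq ?_)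
        rw [pow_mul, ← mul_pow, hKt]
      refine (Finset.sum_le_sum h2).trans ?_
      rw [geom_sum_eq (by norm_num)]
      have : (0 : ℝ) < (1 / 2) ^ (n + 1) := by positivity
      rw [div_le_iff_of_neg (by norm_num)]
      linarith
  refine ⟨2 / t, by positivity, fun n => ?_⟩
  -- The index `0` is separate: the norm bound only gives `2`, while the required bound is 1. There
  -- `u 0 = v 0`.
  rcases Nat.eq_zero_or_pos n with rfl | hn
  · have h0 := h 0
    simp at h0
    rw [h0]
    exact hv 0
  · have h1 : |u n| * t ^ n ≤ truncNorm t (n + 1) U := by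
      have := Finset.single_le_sum (f := fun j => |PowerSeries.coeff j U| * t ^ j)
        (s := Finset.range (n + 1)) (fun j _ => by positivity) (Finset.self_mem_range_succ n)
      simpa only [hU, PowerSeries.coeff_mk, truncNorm] using this
    rw [div_pow, le_div_iff₀ (by positivity)]
    refine (h1.trans (key _)).trans ?_
    exact le_self_pow₀ (by norm_num) (by omega)

/-- The coefficients of the inverse of a power series with exponentially bounded coefficients are
exponentially bounded. -/
theorem exponentiallyBounded_of_mul_eq_one {f g : PowerSeries ℝ} (hfg : g * f = 1)
    (hf0 : PowerSeries.coeff 0 f = 1)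
    (hf : ExponentiallyBounded fun n => PowerSeries.coeff n f) :
    ExponentiallyBounded fun n => PowerSeries.coeff n g := by
  obtain ⟨L, hL, hf⟩ := hf
  refine ⟨2 * L, by positivity, fun n => ?_⟩
  dsimp only at hf ⊢
  induction n using Nat.strong_induction_on with
  | h n ih =>
  have h1 := congrArg (PowerSeries.coeff n) hfg
  rw [PowerSeries.coeff_mul, Finset.Nat.sum_antidiagonal_eq_sum_range_succ_mk,
    Finset.sum_range_succ, Nat.sub_self, hf0, mul_one, PowerSeries.coeff_one] at h1
  rcases Nat.eq_zero_or_pos n with rfl | hn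
  · simp at h1
    simp [h1]
  · rw [if_neg (by omega)] at h1
    rw [eq_neg_of_add_eq_zero_right h1, abs_neg]
    refine (Finset.abs_sum_le_sum_abs _ _).trans ?_
    -- The doubled rate `2 * L` works because the powers 2^k with k < n sum to less than 2^n.
    have h2 : ∀ k ∈ Finset.range n, |PowerSeries.coeff k g * PowerSeries.coeff (n - k) f|
        ≤ L ^ n * 2 ^ k := by
      intro k hk
      have hkn := Finset.mem_range.1 hk
      rw [abs_mul]
      refine (mul_le_mul (ih k hkn) (hf (n - k)) (abs_nonneg _) (by positivity)).trans
        (le_of_eq ?_)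
      rw [mul_pow, ← pow_mul_pow_sub L hkn.le]
      ring
    refine (Finset.sum_le_sum h2).trans ?_
    rw [← Finset.mul_sum, geom_sum_eq (by norm_num), mul_pow, mul_comm]
    refine mul_le_mul_of_nonneg_right ?_ (by positivity)
    norm_num

end Bounds

/-! ### Inverting the functional equation by substitution -/

section Substitution

open PowerSeries

theorem hasSubst_X_mul (g : PowerSeries ℝ) : HasSubst (X * g) :=
  HasSubst.of_constantCoeff_zero' (by simp)

theorem coeff_subst_X_mul_pow (f g : PowerSeries ℝ) (q n : ℕ) :
    coeff n (f.subst (X * g ^ q)) = ∑ k ∈ Finset.range (n + 1),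
      coeff k f * coeff (n - k) (g ^ (q * k)) := by
  rw [coeff_subst' (hasSubst_X_mul _)]
  have h : ∀ k, coeff k f • coeff n ((X * g ^ q) ^ k)
      = if k ≤ n then coeff k f * coeff (n - k) (g ^ (q * k)) else 0 := by
    intro k
    rw [mul_pow, ← pow_mul, coeff_X_pow_mul', smul_eq_mul, mul_ite, mul_zero]
  rw [finsum_congr h, finsum_eq_sum_of_support_subset (s := Finset.range (n + 1))]
  · refine Finset.sum_congr rfl fun k hk => ?_
    rw [if_pos (by simpa [Nat.lt_succ_iff] using hk)]
  · intro k hk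
    rw [Function.mem_support] at hk
    simp only [Finset.coe_range, Set.mem_Iio]
    by_contra hc
    exact hk (if_neg (by omega))

/-- If `M(x) = C(x M(x) ^ q)` then `1 / C(x) = (1 / M)(x / C(x) ^ q)`. -/
theorem inv_eq_subst_inv {M C : PowerSeries ℝ} (q : ℕ) (hM : constantCoeff M = 1)
    (hC : constantCoeff C = 1) (h : M = C.subst (X * M ^ q)) :
    C⁻¹ = (M⁻¹).subst (X * C⁻¹ ^ q) := by
  set w := X * M ^ q with hw
  have hw0 : constantCoeff w = 0 := by simp [hw]
  have hw1 : IsUnit (coeff 1 w) := by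
    have : coeff 1 w = 1 := by
      rw [hw, show (1 : ℕ) = 0 + 1 from rfl, coeff_succ_X_mul]
      simp [hM]
    rw [this]; exact isUnit_one
  -- With `v` the compositional inverse of `w = X * M ^ q`, substituting `v` in the equation gives
  -- M(v) = C. Then w(v) = X reads v C^q = X, so `v = X * C⁻¹ ^ q`.
  have hwv := subst_substInvOfIsUnit_right w hw0 hw1
  have hv : HasSubst (substInvOfIsUnit w hw1) := HasSubst.substInvOfIsUnit w hw1
  set v := substInvOfIsUnit w hw1 with hvdef
  have hMv : M.subst v = C := by
    conv_lhs => rw [h]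
    rw [subst_comp_subst_apply (hasSubst_X_mul _) hv, ← hw, hwv, ← map_algebraMap_eq_subst_X]
    simp
  have hCC : C * C⁻¹ = 1 := PowerSeries.mul_inv_cancel C (by simp [hC])
  have hMM : M * M⁻¹ = 1 := PowerSeries.mul_inv_cancel M (by simp [hM])
  have hJ : (M⁻¹).subst v = C⁻¹ := by
    have h1 : (M * M⁻¹).subst v = (1 : PowerSeries ℝ) := by
      rw [hMM, ← coe_substAlgHom hv, map_one]
    rw [subst_mul hv, hMv] at h1
    calc (M⁻¹).subst v = (C * C⁻¹) * (M⁻¹).subst v := by rw [hCC, one_mul]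
      _ = C⁻¹ * (C * (M⁻¹).subst v) := by ring
      _ = C⁻¹ := by rw [h1, mul_one]
  have hvC : v = X * C⁻¹ ^ q := by
    rw [hw, subst_mul hv, subst_X hv, subst_pow hv, hMv] at hwv
    calc v = v * (C * C⁻¹) ^ q := by rw [hCC, one_pow, mul_one]
      _ = (v * C ^ q) * C⁻¹ ^ q := by rw [mul_pow]; ring
      _ = _ := by rw [hwv]
  rw [← hvC, hJ]

end Substitution

/-! ### The moment-cumulant relation by vertices -/

namespace Distribution

variable {p : ℕ} (a : Distribution p)

theorem halfEdgeMoment_eq (hp : 2 ≤ p) (hpe : Even p) (N : ℕ) :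
    a.halfEdgeMoment N = ∑ s ∈ Finset.range (N + 1), a.halfEdgeCumulant s *
      PowerSeries.coeff (N - s) (a.halfEdgeSeries ^ (s / 2)) := by
  rcases N with _ | n
  · simp [halfEdgeMoment, halfEdgeCumulant]
  -- The added term `s = 0` is a positive-degree coefficient of the zeroth power, hence zero.
  · rw [a.halfEdgeMoment_succ hp hpe, Finset.sum_range_succ' _ (n + 1)]
    simp [PowerSeries.coeff_one]

theorem halfEdgeSeries_eq (hp : 2 ≤ p) :
    a.halfEdgeSeries = (PowerSeries.mk a.moment).expand p (by omega) := by
  ext N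
  rw [halfEdgeSeries, PowerSeries.coeff_mk]
  by_cases h : p ∣ N
  · obtain ⟨n, rfl⟩ := h
    rw [PowerSeries.coeff_expand_mul, PowerSeries.coeff_mk, a.halfEdgeMoment_mul hp]
  · rw [PowerSeries.coeff_expand_of_not_dvd _ _ _ h, a.halfEdgeMoment_of_not_dvd h]

/-- The relation between the moments and the free cumulants. -/
theorem moment_eq (hp : 2 ≤ p) (hpe : Even p) (n : ℕ) :
    a.moment n = ∑ k ∈ Finset.range (n + 1), a.freeCumulant k *
      PowerSeries.coeff (n - k) (PowerSeries.mk a.moment ^ (p / 2 * k)) := by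
  classical
  rw [← a.halfEdgeMoment_mul hp, a.halfEdgeMoment_eq hp hpe]
  -- Only sizes `s = p * k` contribute, and the half-edge series is M(x^p), so the recursion is that
  -- of M after the substitution x^p ↦ x.
  have hinj : Function.Injective (p * ·) := fun x y h => Nat.eq_of_mul_eq_mul_left (by omega) h
  have hsub : (Finset.range (n + 1)).image (p * ·) ⊆ Finset.range (p * n + 1) := by
    intro s hs
    simp only [Finset.mem_image, Finset.mem_range] at hs ⊢
    obtain ⟨k, hk, rfl⟩ := hs
    have := Nat.mul_le_mul_left p (Nat.lt_succ_iff.1 hk)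
    omega
  rw [← Finset.sum_subset hsub, Finset.sum_image fun x _ y _ h => hinj h]
  · refine Finset.sum_congr rfl fun k _ => ?_
    obtain ⟨q, rfl⟩ := hpe
    rw [a.halfEdgeCumulant_mul hp, a.halfEdgeSeries_eq hp, ← Nat.mul_sub, ← map_pow,
      PowerSeries.coeff_expand_mul, show (q + q) * k / 2 = (q + q) / 2 * k by
        rw [← two_mul, mul_assoc, Nat.mul_div_cancel_left _ two_pos,
          Nat.mul_div_cancel_left _ two_pos]]
  · intro s hs hs'
    rw [a.halfEdgeCumulant_of_not_dvd, zero_mul]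
    rintro ⟨k, rfl⟩
    refine hs' (Finset.mem_image.2 ⟨k, ?_, rfl⟩)
    rw [Finset.mem_range, Nat.lt_succ_iff] at hs ⊢
    exact Nat.le_of_mul_le_mul_left hs (by omega)

end Distribution
end TensorFree

theorem mainTheorem6 (p : ℕ) (hp : 2 ≤ p) (hpe : Even p) (a : TensorFree.Distribution p) :
    TensorFree.ExponentiallyBounded a.moment ↔
      TensorFree.ExponentiallyBounded a.freeCumulant := by
  open TensorFree PowerSeries in
  constructor
  · intro h
    set M := mk a.moment with hM
    set C := mk a.freeCumulant with hC
    have hM0 : constantCoeff M = 1 := by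
      rw [← coeff_zero_eq_constantCoeff_apply]; simp [hM, Distribution.moment]
    have hC0 : constantCoeff C = 1 := by
      rw [← coeff_zero_eq_constantCoeff_apply]; simp [hC, Distribution.freeCumulant]
    have hMC : M = C.subst (X * M ^ (p / 2)) := by
      ext n
      rw [coeff_subst_X_mul_pow, hM, coeff_mk, a.moment_eq hp hpe]
      simp [hC]
    -- Bounds are carried from M to 1/M, then through the inverted equation to 1/C, and finally to
    -- C.
    have h1 := inv_eq_subst_inv (p / 2) hM0 hC0 hMC
    have hJ : ExponentiallyBounded fun n => coeff n M⁻¹ :=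
      exponentiallyBounded_of_mul_eq_one (PowerSeries.inv_mul_cancel M (by simp [hM0]))
        (by simpa using hM0) (by simpa [hM] using h)
    have hI : ExponentiallyBounded fun n => coeff n C⁻¹ := by
      refine exponentiallyBounded_of_recursion (p / 2) (fun n => ?_) hJ
      have h2 : mk (fun n => coeff n C⁻¹) = C⁻¹ := by ext; simp
      rw [h2]
      conv_lhs => rw [h1]
      exact coeff_subst_X_mul_pow _ _ _ _
    have := exponentiallyBounded_of_mul_eq_one (f := C⁻¹) (g := C)
      (PowerSeries.mul_inv_cancel C (by simp [hC0])) (by simp [hC0]) hI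
    simpa [hC] using this
  · exact exponentiallyBounded_of_recursion (p / 2) (a.moment_eq hp hpe)
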